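/- **Setting.** *Types:* argument types are $\rho ::= \iota \mid \pi$ and predicate types are $\pi ::= o \mid (\rho\to\pi)$. The language $\mathcal H$ has countably infinitely many variables of every argument type, a non-empty set of individual constants, function symbols of arities $\ge 1$, and predicate constants of predicate types. *Positive expressions* (taken up to renaming of bound variables) are: variables, individual and predicate constants, $\mathsf 0,\mathsf 1:o$, terms $(f\,E_1\cdots E_n):\iota$, applications, abstractions $\lambda V.E:\rho\to\pi$ ($V:\rho$, $E:\pi$), $E_1\bigwedge_\pi E_2$ and $E_1\bigvee_\pi E_2$ of type $\pi$, and the formulas $E_1\approx E_2$ (terms $E_1,E_2$) and $\exists V\,E$ ($V$ of any argument type, $E:o$) of type $o$. A *program* $P$ is a set of clauses $p\leftarrow_\pi E$ with $p:\pi$ a predicate constant and $E:\pi$ a closed positive expression. A *goal* is $\leftarrow A$ with $A$ a positive expression of type $o$, possibly with free variables. *Semantics.* For a non-empty set $D$: $[\![\iota]\!]=D$ with the trivial order, $[\![o]\!]=\{0,1\}$ with $0\le 1$, and $[\![\rho\to\pi]\!]$ is the complete lattice of all monotone maps $\mathcal F(\rho)\to[\![\pi]\!]$ with the pointwise order, where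 $\mathcal F(\iota)=D$ and $\mathcal F(\pi)$ is the set of compact elements of $[\![\pi]\!]$. An interpretation $I$ with domain $D$ assigns elements of $D$ to the individual constants, operations on $D$ to the function symbols, and elements of $[\![\pi]\!]$ to the predicate constants of type $\pi$; a state $s$ assigns an element of $\mathcal F(\rho)$ to every variable of type $\rho$. $[\![E]\!]_s(I)$ is defined as usual: $\bigvee,\bigwedge$ are binary join and meet, $\approx$ is equality, $[\![\lambda V.E]\!]_s(I)$ is $d\mapsto[\![E]\!]_{s[d/V]}(I)$ for $d\in\mathcal F(\rho)$, $\exists V$ ranges over $\mathcal F(\rho)$ (where $V:\rho$), and $[\![E_1E_2]\!]_s(I)=\bigsqcup\{[\![E_1]\!]_s(I)(b) : b\in\mathcal F(\rho),\ b\sqsubseteq[\![E_2]\!]_s(I)\}$ (where $E_2:\rho$). $I$ is a model of $P$ if $[\![E]\!]_s(I)\sqsubseteq I(p)$ for every clause $p\leftarrow_\pi E$ of $P$ and every $s$. Herbrand interpretations are the interpretations over the set of ground terms in which individual constants and function symbols denote themselves; Herbrand states are the states over that set. $M_P$ is the greatest lower bound (pointwise on predicate constants) of all Herbrand models of $P$.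 *SLD-resolution.* A *basic template* is $\mathsf 0$, $\mathsf 1$ or, at a type $\rho_1\to\cdots\to\rho_n\to o$ with $n\ge1$, a non-empty finite union ($\bigvee$) of expressions $\lambda V_1\cdots\lambda V_n.\mathsf 0$ and $\lambda V_1\cdots\lambda V_n.(A_1\wedge\cdots\wedge A_n)$, where $A_i$ is $V_i\approx Z$ if $V_i:\iota$; is $\mathsf 1$ or $V_i$ if $V_i:o$; and otherwise is $\mathsf 1$ or a non-empty finite conjunction of formulas $V_i\,Z_1\cdots Z_r$; all the $Z$'s occurring are pairwise distinct variables, different from the $V_j$. A *basic expression* is a term, a predicate variable, $\mathsf 0$, $\mathsf 1$, or an expression of the same shape as a basic template in which arbitrary basic expressions that do not contain the $V_j$ stand in place of the $Z$'s. Substitutions have finite domain; they are basic if their values are basic expressions, and zero-order if they bind only variables of type $\iota$. An mgu of two terms is a zero-order unifier $\theta$ such that every zero-order unifier is $\theta\gamma$ for some zero-order $\gamma$. The one-step relation $A\xrightarrow{\theta}A'$ is given by ($n\ge 0$ unless indicated, $\epsilon$ the identity substitution, $\Box=\mathsf 1$ the empty clause): 1. $p\,E_1\cdots E_n\xrightarrow{\epsilon}E\,E_1\cdots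 E_n$ for a clause $p\leftarrow_\pi E$ of $P$; 2. $Q\,E_1\cdots E_n\xrightarrow{\theta}(Q\,E_1\cdots E_n)\theta$ with $\theta=\{Q/B_t\}$, where $Q$ is a predicate variable and $B_t$ is a basic template; 3. $(\lambda V.E)\,E_1\cdots E_n\xrightarrow{\epsilon}(E\{V/E_1\})\,E_2\cdots E_n$ ($n\ge1$); 4. $(E'\bigvee_\pi E'')\,E_1\cdots E_n\xrightarrow{\epsilon}E'\,E_1\cdots E_n$, and likewise with result $E''\,E_1\cdots E_n$; 5. $(E'\bigwedge_\pi E'')\,E_1\cdots E_n\xrightarrow{\epsilon}(E'\,E_1\cdots E_n)\wedge(E''\,E_1\cdots E_n)$ for $\pi\ne o$; 6. $E_1\wedge E_2\xrightarrow{\theta}E_1'\wedge E_2\theta$ if $E_1\xrightarrow{\theta}E_1'$, and symmetrically in $E_2$; 7. $\Box\wedge E\xrightarrow{\epsilon}E$ and $E\wedge\Box\xrightarrow{\epsilon}E$; 8. $(E_1\approx E_2)\xrightarrow{\theta}\Box$ for an mgu $\theta$ of $E_1,E_2$; 9. $\exists V\,E\xrightarrow{\epsilon}E$. An *SLD-refutation*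 of $P\cup\{\leftarrow A\}$ is a finite sequence $A=A_0\xrightarrow{\theta_1}A_1\cdots\xrightarrow{\theta_n}A_n=\Box$ ($n\ge 0$, all $\theta_i$ basic) in which the free variables of each template used in 2, and the variable $V$ (a bound variable, renamed if necessary) released in 9, are different from all variables that have appeared earlier in the sequence. Its *computed answer* is the restriction of $\theta_1\cdots\theta_n$ to the free variables of $A$. **Theorem.** Let $P$ be a program and $\leftarrow A$ a goal. Assume that the number of free variables of type $\iota$ in $A$ is at most the number of individual constants of $\mathcal H$ that occur neither in $P$ nor in $A$ (this holds automatically if $A$ has no free variable of type $\iota$, or if infinitely many individual constants do not occur in $P$, for instance if $P$ is finite and $\mathcal H$ has infinitely many individual constants). If $[\![A]\!]_s(M_P)=1$ for all Herbrand states $s$, then there exists an SLD-refutation of $P\cup\{\leftarrow A\}$ whose computed answer is the identity substitution. -/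

import Mathlib

namespace HOLP

/-! ## Types -/

mutual
  /-- Argument types: the type of individuals, or a predicate type. -/
  inductive ATy : Type
    | i : ATy
    | pred : PTy → ATy
  /-- Predicate types: the type of truth values, or `ρ → π`. -/
  inductive PTy : Type
    | o : PTy
    | arr : ATy → PTy → PTy
end

/-- The non-logical symbols of the language. A function symbol in `Func n` has arity `n + 1`. -/
structure Sig where
  Const : Type
  Func : ℕ → Type
  Pred : PTy → Type

/-- Argument variables: countably many of every argument type. -/
abbrev Var : Type := ATy × ℕ

/-- Typed de Bruijn indices: positions of `ρ` in the list of binders in scope. -/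
inductive Mem : ATy → List ATy → Type
  | zero {ρ : ATy} {Γ : List ATy} : Mem ρ (ρ :: Γ)
  | succ {ρ τ : ATy} {Γ : List ATy} : Mem ρ Γ → Mem ρ (τ :: Γ)

/-! ## Positive expressions -/

/-- Positive expressions of type `ρ` up to renaming of bound variables: free variables are named,
bound variables are de Bruijn indices into `Γ`. The expressions of the language are those with
`Γ = []`. -/
inductive Expr (S : Sig) : List ATy → ATy → Type
  | fvar {Γ : List ATy} (ρ : ATy) (n : ℕ) : Expr S Γ ρ
  | bvar {Γ : List ATy} {ρ : ATy} (x : Mem ρ Γ) : Expr S Γ ρ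
  | const {Γ : List ATy} (c : S.Const) : Expr S Γ .i
  | func {Γ : List ATy} {n : ℕ} (f : S.Func n) (ts : Fin (n + 1) → Expr S Γ .i) : Expr S Γ .i
  | pconst {Γ : List ATy} {π : PTy} (p : S.Pred π) : Expr S Γ (.pred π)
  | bot {Γ : List ATy} : Expr S Γ (.pred .o)
  | top {Γ : List ATy} : Expr S Γ (.pred .o)
  | app {Γ : List ATy} {ρ : ATy} {π : PTy} (E₁ : Expr S Γ (.pred (.arr ρ π))) (E₂ : Expr S Γ ρ) :
      Expr S Γ (.pred π)
  | lam {Γ : List ATy} {ρ : ATy} {π : PTy} (E : Expr S (ρ :: Γ) (.pred π)) :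
      Expr S Γ (.pred (.arr ρ π))
  | and {Γ : List ATy} {π : PTy} (E₁ E₂ : Expr S Γ (.pred π)) : Expr S Γ (.pred π)
  | or {Γ : List ATy} {π : PTy} (E₁ E₂ : Expr S Γ (.pred π)) : Expr S Γ (.pred π)
  | eq {Γ : List ATy} (E₁ E₂ : Expr S Γ .i) : Expr S Γ (.pred .o)
  | ex {Γ : List ATy} {ρ : ATy} (E : Expr S (ρ :: Γ) (.pred .o)) : Expr S Γ (.pred .o)

namespace Expr

variable {S : Sig}

/-- The set of free variables. -/
def FV : {Γ : List ATy} → {ρ : ATy} → Expr S Γ ρ → Set Var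
  | _, _, fvar ρ n => {(ρ, n)}
  | _, _, bvar _ => ∅
  | _, _, const _ => ∅
  | _, _, func _ ts => ⋃ j, (ts j).FV
  | _, _, pconst _ => ∅
  | _, _, bot => ∅
  | _, _, top => ∅
  | _, _, app E₁ E₂ => E₁.FV ∪ E₂.FV
  | _, _, lam E => E.FV
  | _, _, and E₁ E₂ => E₁.FV ∪ E₂.FV
  | _, _, or E₁ E₂ => E₁.FV ∪ E₂.FV
  | _, _, eq E₁ E₂ => E₁.FV ∪ E₂.FV
  | _, _, ex E => E.FV

/-- The set of individual constants that occur in an expression. -/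
def consts : {Γ : List ATy} → {ρ : ATy} → Expr S Γ ρ → Set S.Const
  | _, _, fvar _ _ => ∅
  | _, _, bvar _ => ∅
  | _, _, const c => {c}
  | _, _, func _ ts => ⋃ j, (ts j).consts
  | _, _, pconst _ => ∅
  | _, _, bot => ∅
  | _, _, top => ∅
  | _, _, app E₁ E₂ => E₁.consts ∪ E₂.consts
  | _, _, lam E => E.consts
  | _, _, and E₁ E₂ => E₁.consts ∪ E₂.consts
  | _, _, or E₁ E₂ => E₁.consts ∪ E₂.consts
  | _, _, eq E₁ E₂ => E₁.consts ∪ E₂.consts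
  | _, _, ex E => E.consts

/-- Extension of a map of indices under a binder. -/
def liftRen {Γ Δ : List ATy} (r : ∀ ρ, Mem ρ Γ → Mem ρ Δ) {τ : ATy} :
    ∀ ρ, Mem ρ (τ :: Γ) → Mem ρ (τ :: Δ)
  | _, .zero => .zero
  | _, .succ x => .succ (r _ x)

/-- Renaming of de Bruijn indices. -/
def rename : {Γ : List ATy} → {ρ : ATy} → Expr S Γ ρ →
    {Δ : List ATy} → (∀ ρ, Mem ρ Γ → Mem ρ Δ) → Expr S Δ ρ
  | _, _, fvar ρ n, _, _ => fvar ρ n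
  | _, _, bvar x, _, r => bvar (r _ x)
  | _, _, const c, _, _ => const c
  | _, _, func f ts, _, r => func f fun j => (ts j).rename r
  | _, _, pconst p, _, _ => pconst p
  | _, _, bot, _, _ => bot
  | _, _, top, _, _ => top
  | _, _, app E₁ E₂, _, r => app (E₁.rename r) (E₂.rename r)
  | _, _, lam E, _, r => lam (E.rename (liftRen r))
  | _, _, and E₁ E₂, _, r => and (E₁.rename r) (E₂.rename r)
  | _, _, or E₁ E₂, _, r => or (E₁.rename r) (E₂.rename r)
  | _, _, eq E₁ E₂, _, r => eq (E₁.rename r) (E₂.rename r)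
  | _, _, ex E, _, r => ex (E.rename (liftRen r))

/-- The same expression in a context with one more binder. -/
def wk {Γ : List ATy} {ρ τ : ATy} (E : Expr S Γ ρ) : Expr S (τ :: Γ) ρ :=
  E.rename fun _ x => .succ x

/-- An expression that refers to no binder, placed under the binders `Γ`. -/
def weaken {ρ : ATy} (E : Expr S [] ρ) (Γ : List ATy) : Expr S Γ ρ :=
  E.rename fun _ x => nomatch x

/-- Extension under a binder of a substitution for the indices. -/
def liftB {Γ Δ : List ATy} (b : ∀ ρ, Mem ρ Γ → Expr S Δ ρ) {τ : ATy} :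
    ∀ ρ, Mem ρ (τ :: Γ) → Expr S (τ :: Δ) ρ
  | _, .zero => bvar .zero
  | _, .succ x => (b _ x).wk

/-- Simultaneous capture-avoiding substitution for the indices (`b`) and the free
variables (`f`). -/
def bind : {Γ : List ATy} → {ρ : ATy} → Expr S Γ ρ → {Δ : List ATy} →
    (∀ ρ, Mem ρ Γ → Expr S Δ ρ) → (∀ ρ, ℕ → Expr S Δ ρ) → Expr S Δ ρ
  | _, _, fvar ρ n, _, _, f => f ρ n
  | _, _, bvar x, _, b, _ => b _ x
  | _, _, const c, _, _, _ => const c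
  | _, _, func g ts, _, b, f => func g fun j => (ts j).bind b f
  | _, _, pconst p, _, _, _ => pconst p
  | _, _, bot, _, _, _ => bot
  | _, _, top, _, _, _ => top
  | _, _, app E₁ E₂, _, b, f => app (E₁.bind b f) (E₂.bind b f)
  | _, _, lam E, _, b, f => lam (E.bind (liftB b) fun ρ n => (f ρ n).wk)
  | _, _, and E₁ E₂, _, b, f => and (E₁.bind b f) (E₂.bind b f)
  | _, _, or E₁ E₂, _, b, f => or (E₁.bind b f) (E₂.bind b f)
  | _, _, eq E₁ E₂, _, b, f => eq (E₁.bind b f) (E₂.bind b f)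
  | _, _, ex E, _, b, f => ex (E.bind (liftB b) fun ρ n => (f ρ n).wk)

/-- The substitution of `E₁` for the outermost index. -/
def instB {τ : ATy} (E₁ : Expr S [] τ) : ∀ ρ, Mem ρ [τ] → Expr S [] ρ
  | _, .zero => E₁
  | _, .succ x => nomatch x

/-- `E{V/E₁}`, where `V` is the variable bound by the binder just removed from `E`. -/
def inst {τ ρ : ATy} (E : Expr S [τ] ρ) (E₁ : Expr S [] τ) : Expr S [] ρ :=
  E.bind (instB E₁) fvar

/-- The conjunction of a list of formulas; a nonempty list is bracketed to the right. -/
def conj {Γ : List ATy} : List (Expr S Γ (.pred .o)) → Expr S Γ (.pred .o)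
  | [] => top
  | [A] => A
  | A :: B :: l => and A (conj (B :: l))

/-- The union `E₁ ∨ ⋯ ∨ Eₖ` of the nonempty list `E :: l`, bracketed to the right. -/
def disj {Γ : List ATy} {π : PTy} (E : Expr S Γ (.pred π)) :
    List (Expr S Γ (.pred π)) → Expr S Γ (.pred π)
  | [] => E
  | E' :: l => or E (disj E' l)

end Expr

/-! ## Semantics of types -/

/-- A bundled partially ordered set. -/
structure PO where
  carrier : Type
  inst : PartialOrder carrier

/-- A bundled complete lattice. -/
structure CL where
  carrier : Type
  inst : CompleteLattice carrier

attribute [instance] PO.inst CL.inst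

/-- The trivial partial order. -/
@[reducible]
def discreteOrder (D : Type) : PartialOrder D where
  le a b := a = b
  le_refl _ := rfl
  le_trans _ _ _ h₁ h₂ := h₁.trans h₂
  le_antisymm _ _ h _ := h

mutual
  /-- `⟦π⟧_D`: truth values, or the monotone maps from the basic elements of `ρ` to `⟦π⟧_D`.
  The truth values `0`, `1` are `False`, `True`. -/
  def semP (D : Type) : PTy → CL
    | .o => ⟨Prop, inferInstance⟩
    | .arr ρ π => ⟨(semF D ρ).carrier →o (semP D π).carrier, inferInstance⟩
  /-- The basic elements of type `ρ`: `D` with the trivial order, or the compact elements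
  of `⟦π⟧_D`. -/
  def semF (D : Type) : ATy → PO
    | .i => ⟨D, discreteOrder D⟩
    | .pred π => ⟨{c : (semP D π).carrier // IsCompactElement c}, inferInstance⟩
end

/-- `⟦π⟧_D` as a type. -/
abbrev SemP (D : Type) (π : PTy) : Type := (semP D π).carrier

/-- The basic elements of type `ρ` as a type. -/
abbrev Basis (D : Type) (ρ : ATy) : Type := (semF D ρ).carrier

/-- `⟦ρ⟧_D` for an argument type `ρ`. -/
def semA (D : Type) : ATy → PO
  | .i => ⟨D, discreteOrder D⟩
  | .pred π => ⟨SemP D π, inferInstance⟩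

/-- `⟦ρ⟧_D` as a type. -/
abbrev SemA (D : Type) (ρ : ATy) : Type := (semA D ρ).carrier

/-- The inclusion of the basic elements of type `ρ` in `⟦ρ⟧_D`. -/
def basisIncl (D : Type) : (ρ : ATy) → Basis D ρ →o SemA D ρ
  | .i => OrderHom.id
  | .pred π => (⟨Subtype.val, fun _ _ h => h⟩ : {c : SemP D π // IsCompactElement c} →o SemP D π)

/-! ## Semantics of expressions -/

/-- A state over `D`. -/
abbrev State (D : Type) : Type := ∀ ρ : ATy, ℕ → Basis D ρ

/-- Values for the binders in scope, together with a state. -/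
abbrev Env (D : Type) (Γ : List ATy) : Type := (∀ ρ : ATy, Mem ρ Γ → Basis D ρ) × State D

/-- Extension of the values of the binders. -/
def consB {D : Type} {Γ : List ATy} {τ : ATy} (d : Basis D τ) (b : ∀ ρ, Mem ρ Γ → Basis D ρ) :
    ∀ ρ, Mem ρ (τ :: Γ) → Basis D ρ
  | _, .zero => d
  | _, .succ x => b _ x

/-- `s[d/V]`, for the variable `V` bound by the innermost binder. -/
def Env.cons {D : Type} {Γ : List ATy} {τ : ATy} (e : Env D Γ) (d : Basis D τ) :
    Env D (τ :: Γ) :=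
  (consB d e.1, e.2)

theorem Env.cons_mono {D : Type} {Γ : List ATy} {τ : ATy} {e e' : Env D Γ} {d d' : Basis D τ}
    (he : e ≤ e') (hd : d ≤ d') : e.cons d ≤ e'.cons d' := by
  refine ⟨fun ρ x => ?_, he.2⟩
  cases x with
  | zero => exact hd
  | succ x => exact he.1 _ x

/-- Interpretations of the language. -/
structure Interp (S : Sig) where
  D : Type
  nonempty : Nonempty D
  const : S.Const → D
  func : {n : ℕ} → S.Func n → (Fin (n + 1) → D) → D
  pred : {π : PTy} → S.Pred π → SemP D π

section Denotation

variable {D : Type} {Γ : List ATy}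

/-- An element of `⟦ρ → π⟧_D` as a monotone map. -/
def toHom {ρ : ATy} {π : PTy} (f : SemP D (.arr ρ π)) : Basis D ρ →o SemP D π := f

/-- Semantics of application: the least upper bound of the values of the function at the basic
elements below the argument. -/
def appSem {ρ : ATy} {π : PTy} (f : SemP D (.arr ρ π)) (a : SemA D ρ) : SemP D π :=
  ⨆ b : {b : Basis D ρ // basisIncl D ρ b ≤ a}, toHom f b.1

theorem appSem_mono {ρ : ATy} {π : PTy} {f g : SemP D (.arr ρ π)} {a a' : SemA D ρ}
    (hf : f ≤ g) (ha : a ≤ a') : appSem f a ≤ appSem g a' := by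
  refine iSup_le fun b => ?_
  have hfg : toHom f b.1 ≤ toHom g b.1 := hf b.1
  exact hfg.trans (le_iSup (fun b : {b : Basis D ρ // basisIncl D ρ b ≤ a'} => toHom g b.1)
    ⟨b.1, b.2.trans ha⟩)

/-- Semantics of abstraction. -/
def lamSem {ρ : ATy} {π : PTy} (F : Env D (ρ :: Γ) →o SemP D π) : Env D Γ →o SemP D (.arr ρ π) where
  toFun e := (⟨fun d => F (e.cons d), fun _ _ h => F.monotone (Env.cons_mono le_rfl h)⟩ :
    Basis D ρ →o SemP D π)
  monotone' _ _ h := fun _ => F.monotone (Env.cons_mono h le_rfl)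

/-- Semantics of conjunction: the greatest lower bound in `⟦π⟧_D`. -/
def andSem {π : PTy} (F G : Env D Γ →o SemP D π) : Env D Γ →o SemP D π := F ⊓ G

/-- Semantics of disjunction: the least upper bound in `⟦π⟧_D`. -/
def orSem {π : PTy} (F G : Env D Γ →o SemP D π) : Env D Γ →o SemP D π := F ⊔ G

/-- Semantics of equality. -/
def eqSem (F G : Env D Γ →o SemA D .i) : Env D Γ →o SemP D .o where
  toFun e := (F e = G e : Prop)
  monotone' _ _ h := fun hFG => by
    have h₁ : F _ = F _ := F.monotone h
    have h₂ : G _ = G _ := G.monotone h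
    exact h₁.symm.trans (Eq.trans hFG h₂)

/-- Semantics of the existential quantifier. -/
def exSem {ρ : ATy} (F : Env D (ρ :: Γ) →o SemP D .o) : Env D Γ →o SemP D .o where
  toFun e := (∃ d : Basis D ρ, F (e.cons d) : Prop)
  monotone' _ _ h := fun ⟨d, hd⟩ => ⟨d, F.monotone (Env.cons_mono h le_rfl) hd⟩

end Denotation

/-- The semantics `⟦E⟧_s(I)` of positive expressions, which is monotone in the state. -/
def Expr.denote {S : Sig} (I : Interp S) :
    {Γ : List ATy} → {ρ : ATy} → Expr S Γ ρ → (Env I.D Γ →o SemA I.D ρ)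
  | _, _, .fvar ρ n => ⟨fun e => basisIncl I.D ρ (e.2 ρ n),
      fun _ _ h => (basisIncl I.D ρ).monotone (h.2 ρ n)⟩
  | _, _, .bvar x => ⟨fun e => basisIncl I.D _ (e.1 _ x),
      fun _ _ h => (basisIncl I.D _).monotone (h.1 _ x)⟩
  | _, _, .const c => ⟨fun _ => I.const c, fun _ _ _ => le_rfl⟩
  | _, _, .func f ts => ⟨fun e => I.func f fun j => (ts j).denote I e,
      fun _ _ h => congrArg (I.func f) (funext fun j => ((ts j).denote I).monotone h)⟩
  | _, _, .pconst p => ⟨fun _ => I.pred p, fun _ _ _ => le_rfl⟩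
  | _, _, .bot => ⟨fun _ => False, fun _ _ _ => le_rfl⟩
  | _, _, .top => ⟨fun _ => True, fun _ _ _ => le_rfl⟩
  | _, _, .app E₁ E₂ => ⟨fun e => appSem (E₁.denote I e) (E₂.denote I e),
      fun _ _ h => appSem_mono ((E₁.denote I).monotone h) ((E₂.denote I).monotone h)⟩
  | _, _, .lam E => lamSem (E.denote I)
  | _, _, .and E₁ E₂ => andSem (E₁.denote I) (E₂.denote I)
  | _, _, .or E₁ E₂ => orSem (E₁.denote I) (E₂.denote I)
  | _, _, .eq E₁ E₂ => eqSem (E₁.denote I) (E₂.denote I)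
  | _, _, .ex E => exSem (E.denote I)

/-- `⟦E⟧_s(I)` for an expression of predicate type. -/
def Expr.value {S : Sig} {π : PTy} (E : Expr S [] (.pred π)) (I : Interp S) (s : State I.D) :
    SemP I.D π :=
  E.denote I ((fun _ x => nomatch x), s)

/-! ## Programs, Herbrand interpretations and the minimum Herbrand model -/

/-- Program clauses `p ← E` with `E` closed. -/
structure Clause (S : Sig) where
  type : PTy
  head : S.Pred type
  body : Expr S [] (.pred type)
  closed : body.FV = ∅

/-- Programs. -/
abbrev Program (S : Sig) : Type := Set (Clause S)

/-- Goal clauses `← A`, given by the formula `A`. -/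
abbrev Goal (S : Sig) : Type := Expr S [] (.pred .o)

/-- `⟦A⟧_s(I) = 1`. -/
def Expr.IsTrue {S : Sig} (A : Goal S) (I : Interp S) (s : State I.D) : Prop :=
  A.value I s

/-- `I` is a model of `P`. -/
def Interp.IsModel {S : Sig} (I : Interp S) (P : Program S) : Prop :=
  ∀ cl ∈ P, ∀ s : State I.D, cl.body.value I s ≤ I.pred cl.head

/-- The Herbrand universe. -/
inductive GTerm (S : Sig) : Type
  | const (c : S.Const) : GTerm S
  | func {n : ℕ} (f : S.Func n) (ts : Fin (n + 1) → GTerm S) : GTerm S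

instance {S : Sig} [h : Nonempty S.Const] : Nonempty (GTerm S) := h.map GTerm.const

/-- Herbrand interpretations, given by the values of the predicate constants and ordered
pointwise. -/
abbrev HInterp (S : Sig) : Type := ∀ π : PTy, S.Pred π → SemP (GTerm S) π

/-- The interpretation that a Herbrand interpretation stands for. -/
def HInterp.toInterp {S : Sig} [Nonempty S.Const] (I : HInterp S) : Interp S where
  D := GTerm S
  nonempty := inferInstance
  const := GTerm.const
  func := GTerm.func
  pred p := I _ p

/-- The greatest lower bound of all Herbrand models of `P`. -/
def minModel {S : Sig} [Nonempty S.Const] (P : Program S) : HInterp S :=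
  sInf {I | I.toInterp.IsModel P}

/-! ## Substitutions and unifiers -/

/-- Substitutions: maps from variables to expressions of the same type that move only finitely
many variables. -/
@[ext]
structure Subst (S : Sig) where
  toFun : (ρ : ATy) → ℕ → Expr S [] ρ
  finite : {v : Var | toFun v.1 v.2 ≠ .fvar v.1 v.2}.Finite

/-- `Eθ`. -/
def Expr.subst {S : Sig} {ρ : ATy} (E : Expr S [] ρ) (θ : Subst S) : Expr S [] ρ :=
  E.bind (fun _ x => nomatch x) θ.toFun

namespace Subst

variable {S : Sig}

/-- The domain of a substitution. -/
def dom (θ : Subst S) : Set Var := {v | θ.toFun v.1 v.2 ≠ .fvar v.1 v.2}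

/-- The variables that occur in the bindings of a substitution. -/
def vars (θ : Subst S) : Set Var := θ.dom ∪ ⋃ v ∈ θ.dom, (θ.toFun v.1 v.2).FV

/-- The identity substitution. -/
def id : Subst S where
  toFun := .fvar
  finite := by simp

open Classical in
/-- The substitution `{V/E}`. -/
noncomputable def single (τ : ATy) (m : ℕ) (E : Expr S [] τ) : Subst S where
  toFun ρ n := if h : τ = ρ ∧ m = n then h.1 ▸ E else .fvar ρ n
  finite := by
    refine (Set.finite_singleton ((τ, m) : Var)).subset fun v hv => ?_
    by_contra hne
    refine hv (dif_neg fun h => hne ?_)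
    exact Prod.ext h.1.symm h.2.symm

/-- The composition `θσ`: first `θ`, then `σ`. -/
def comp (θ σ : Subst S) : Subst S where
  toFun ρ n := (θ.toFun ρ n).subst σ
  finite := by
    refine (θ.finite.union σ.finite).subset fun v hv => ?_
    by_contra hne
    simp only [Set.mem_union, Set.mem_ofPred_eq, not_or, not_not] at hne
    exact hv (by rw [hne.1]; exact hne.2)

open Classical in
/-- The restriction of a substitution to a set of variables. -/
noncomputable def restrict (θ : Subst S) (V : Set Var) : Subst S where
  toFun ρ n := if (ρ, n) ∈ V then θ.toFun ρ n else .fvar ρ n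
  finite := by
    refine θ.finite.subset fun v hv hθ => hv ?_
    change (if v ∈ V then θ.toFun v.1 v.2 else .fvar v.1 v.2) = _
    split
    · exact hθ
    · rfl

/-- The composition `θ₁ ⋯ θₙ` of a list of substitutions. -/
def compList (θs : List (Subst S)) : Subst S := θs.foldr comp id

/-- `θ` binds individual variables only. -/
def IsZeroOrder (θ : Subst S) : Prop := ∀ v ∈ θ.dom, v.1 = .i

/-- `θ` is a unifier of two terms. -/
def IsUnifier (θ : Subst S) (t₁ t₂ : Expr S [] .i) : Prop :=
  θ.IsZeroOrder ∧ t₁.subst θ = t₂.subst θ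

/-- `θ` is a most general unifier of two terms. -/
def IsMGU (θ : Subst S) (t₁ t₂ : Expr S [] .i) : Prop :=
  θ.IsUnifier t₁ t₂ ∧
    ∀ σ : Subst S, σ.IsUnifier t₁ t₂ → ∃ γ : Subst S, γ.IsZeroOrder ∧ σ = θ.comp γ

end Subst

/-! ## Basic expressions and basic templates -/

/-- Argument lists `E₁, …, Eₙ` for an expression of type `ρ₁ → ⋯ → ρₙ → o`. -/
inductive Args (S : Sig) : PTy → Type
  | nil : Args S .o
  | cons {ρ : ATy} {π : PTy} (E : Expr S [] ρ) (as : Args S π) : Args S (.arr ρ π)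

/-- The application `E E₁ ⋯ Eₙ`. -/
def Args.apply {S : Sig} : {π : PTy} → Args S π → Expr S [] (.pred π) → Expr S [] (.pred .o)
  | _, .nil, E => E
  | _, .cons E₁ as, E => as.apply (.app E E₁)

/-- The application `E E₁ ⋯ Eₙ`, under the binders `Γ`. -/
def Args.applyUnder {S : Sig} {Γ : List ATy} : {π : PTy} → Args S π → Expr S Γ (.pred π) →
    Expr S Γ (.pred .o)
  | _, .nil, E => E
  | _, .cons E₁ as, E => as.applyUnder (.app E (E₁.weaken Γ))

/-- The members of an argument list, with their types. -/
def Args.toList {S : Sig} : {π : PTy} → Args S π → List (Σ ρ, Expr S [] ρ)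
  | _, .nil => []
  | _, .cons E as => ⟨_, E⟩ :: as.toList

/-- The conditions on one argument `V : ρ` that a basic expression may impose: `V ≈ B` if `ρ = ι`;
`1` if `ρ` is a predicate type; `V` if `ρ = o`; and
`V(B₁₁)⋯(B₁ᵣ) ∧ ⋯ ∧ V(Bₘ₁)⋯(Bₘᵣ)` with `m > 0` for any other `ρ`. As the `B`s come from the empty
context, they contain none of the variables bound by the basic expression. -/
inductive Cond (S : Sig) : ATy → Type
  | eq (B : Expr S [] .i) : Cond S .i
  | one {π : PTy} : Cond S (.pred π)
  | var : Cond S (.pred .o)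
  | apps {ρ : ATy} {π : PTy} (B : Args S (.arr ρ π)) (Bs : List (Args S (.arr ρ π))) :
      Cond S (.pred (.arr ρ π))

/-- The formula of a condition on the variable `x`. -/
def Cond.toExpr {S : Sig} {Δ : List ATy} : {ρ : ATy} → Cond S ρ → Mem ρ Δ → Expr S Δ (.pred .o)
  | _, .eq B, x => .eq (.bvar x) (B.weaken Δ)
  | _, .one, _ => .top
  | _, .var, x => .bvar x
  | _, .apps B Bs, x => Expr.conj ((B :: Bs).map fun as => as.applyUnder (.bvar x))

/-- The basic subexpressions in a condition. -/
def Cond.subexprs {S : Sig} : {ρ : ATy} → Cond S ρ → List (Σ ρ, Expr S [] ρ)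
  | _, .eq B => [⟨_, B⟩]
  | _, .one => []
  | _, .var => []
  | _, .apps B Bs => (B :: Bs).flatMap Args.toList

/-- One condition for each argument of the type `ρ₁ → ⋯ → ρₙ → o`. -/
inductive Conds (S : Sig) : PTy → Type
  | nil : Conds S .o
  | cons {ρ : ATy} {π : PTy} (A : Cond S ρ) (As : Conds S π) : Conds S (.arr ρ π)

/-- `λVₖ. ⋯ λVₙ. (A₁ ∧ ⋯ ∧ Aₙ)`, where `acc` lists `A₁, …, Aₖ₋₁`. -/
def Conds.abs {S : Sig} : {Δ : List ATy} → {π : PTy} → Conds S π → List (Expr S Δ (.pred .o)) →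
    Expr S Δ (.pred π)
  | _, _, .nil, acc => Expr.conj acc
  | _, _, .cons A As, acc => .lam (As.abs (acc.map Expr.wk ++ [A.toExpr .zero]))

/-- The basic subexpressions in a list of conditions. -/
def Conds.subexprs {S : Sig} : {π : PTy} → Conds S π → List (Σ ρ, Expr S [] ρ)
  | _, .nil => []
  | _, .cons A As => A.subexprs ++ As.subexprs

/-- `λV₁. ⋯ λVₙ. 0`. -/
def lamZero (S : Sig) : (Δ : List ATy) → (π : PTy) → Expr S Δ (.pred π)
  | _, .o => .bot
  | Δ, .arr ρ π => .lam (lamZero S (ρ :: Δ) π)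

/-- The members of the unions that form basic expressions. -/
inductive Piece (S : Sig) (π : PTy) : Type
  | zero : Piece S π
  | conds (As : Conds S π) : Piece S π

/-- The expression of a piece. -/
def Piece.toExpr {S : Sig} {π : PTy} : Piece S π → Expr S [] (.pred π)
  | .zero => lamZero S [] π
  | .conds As => As.abs []

/-- The basic subexpressions in a piece. -/
def Piece.subexprs {S : Sig} {π : PTy} : Piece S π → List (Σ ρ, Expr S [] ρ)
  | .zero => []
  | .conds As => As.subexprs

/-- The union of a nonempty list of pieces. -/
def unionExpr {S : Sig} {π : PTy} (B : Piece S π) (Bs : List (Piece S π)) : Expr S [] (.pred π) :=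
  Expr.disj B.toExpr (Bs.map Piece.toExpr)

/-- Basic expressions. -/
inductive IsBasic {S : Sig} : {ρ : ATy} → Expr S [] ρ → Prop
  | term (t : Expr S [] .i) : IsBasic t
  | var (π : PTy) (n : ℕ) : IsBasic (.fvar (.pred π) n)
  | zero : IsBasic (.bot : Expr S [] (.pred .o))
  | one : IsBasic (.top : Expr S [] (.pred .o))
  | union {ρ : ATy} {π : PTy} (B : Piece S (.arr ρ π)) (Bs : List (Piece S (.arr ρ π)))
      (h : ∀ E ∈ (B :: Bs).flatMap Piece.subexprs, IsBasic E.2) : IsBasic (unionExpr B Bs)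

/-- Basic templates: `0`, `1` and the unions all of whose basic subexpressions are distinct
variables. -/
inductive IsTemplate {S : Sig} : {π : PTy} → Expr S [] (.pred π) → Prop
  | zero : IsTemplate (.bot : Expr S [] (.pred .o))
  | one : IsTemplate (.top : Expr S [] (.pred .o))
  | union {ρ : ATy} {π : PTy} (B : Piece S (.arr ρ π)) (Bs : List (Piece S (.arr ρ π)))
      (vs : List Var) (hvs : vs.Nodup)
      (h : (B :: Bs).flatMap Piece.subexprs =
        vs.map fun v => (⟨v.1, .fvar v.1 v.2⟩ : Σ ρ, Expr S [] ρ)) : IsTemplate (unionExpr B Bs)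

/-- All bindings of `θ` are basic expressions. -/
def Subst.IsBasic {S : Sig} (θ : Subst S) : Prop := ∀ v ∈ θ.dom, HOLP.IsBasic (θ.toFun v.1 v.2)

/-! ## SLD-resolution -/

/-- `Step P U A θ A'`: the formula `A'` is derived in one step from `A` using `θ`, where the template
variables, and the variable released from an existential quantifier, are chosen outside the set
`U` of variables already in use. The empty clause is `1`. -/
inductive Step {S : Sig} (P : Program S) (U : Set Var) : Goal S → Subst S → Goal S → Prop
  | clause (cl : Clause S) (hcl : cl ∈ P) (as : Args S cl.type) :
      Step P U (as.apply (.pconst cl.head)) .id (as.apply cl.body)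
  | template {π : PTy} (n : ℕ) (as : Args S π) (B : Expr S [] (.pred π)) (hB : IsTemplate B)
      (hU : Disjoint B.FV U) :
      Step P U (as.apply (.fvar (.pred π) n)) (.single (.pred π) n B)
        ((as.apply (.fvar (.pred π) n) : Goal S).subst (.single (.pred π) n B))
  | beta {ρ : ATy} {π : PTy} (E : Expr S [ρ] (.pred π)) (E₁ : Expr S [] ρ) (as : Args S π) :
      Step P U ((Args.cons E₁ as).apply (.lam E)) .id (as.apply (E.inst E₁))
  | orLeft {π : PTy} (E' E'' : Expr S [] (.pred π)) (as : Args S π) :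
      Step P U (as.apply (.or E' E'')) .id (as.apply E')
  | orRight {π : PTy} (E' E'' : Expr S [] (.pred π)) (as : Args S π) :
      Step P U (as.apply (.or E' E'')) .id (as.apply E'')
  | andApply {ρ : ATy} {π : PTy} (E' E'' : Expr S [] (.pred (.arr ρ π))) (as : Args S (.arr ρ π)) :
      Step P U (as.apply (.and E' E'')) .id (.and (as.apply E') (as.apply E''))
  | andLeft {E₁ E₁' : Goal S} (E₂ : Goal S) {θ : Subst S} (h : Step P U E₁ θ E₁') :
      Step P U (.and E₁ E₂) θ (.and E₁' (E₂.subst θ))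
  | andRight (E₁ : Goal S) {E₂ E₂' : Goal S} {θ : Subst S} (h : Step P U E₂ θ E₂') :
      Step P U (.and E₁ E₂) θ (.and (E₁.subst θ) E₂')
  | oneAnd (E : Goal S) : Step P U (.and .top E) .id E
  | andOne (E : Goal S) : Step P U (.and E .top) .id E
  | unify (t₁ t₂ : Expr S [] .i) (θ : Subst S) (hθ : θ.IsMGU t₁ t₂) :
      Step P U (.eq t₁ t₂) θ .top
  | exists {ρ : ATy} (E : Expr S [ρ] (.pred .o)) (n : ℕ) (hn : (ρ, n) ∉ U) :
      Step P U (.ex E) .id (E.inst (.fvar ρ n))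

/-- `Derivation P U A θs A'`: a finite SLD-derivation from `A` to `A'` with the basic
substitutions `θs`, where `U` is the set of the variables that have appeared up to and
including `A`. -/
inductive Derivation {S : Sig} (P : Program S) :
    Set Var → Goal S → List (Subst S) → Goal S → Prop
  | nil (U : Set Var) (A : Goal S) : Derivation P U A [] A
  | cons {U : Set Var} {A A₁ A' : Goal S} {θ : Subst S} {θs : List (Subst S)}
      (hθ : θ.IsBasic) (h : Step P U A θ A₁)
      (hs : Derivation P (U ∪ θ.vars ∪ A₁.FV) A₁ θs A') : Derivation P U A (θ :: θs) A'

/-- The goal `← A` has an SLD-refutation with the substitutions `θs`. -/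
def IsRefutation {S : Sig} (P : Program S) (A : Goal S) (θs : List (Subst S)) : Prop :=
  Derivation P A.FV A θs .top

/-- `σ` is a computed answer for `P ∪ {← A}`. -/
def IsComputedAnswer {S : Sig} (P : Program S) (A : Goal S) (σ : Subst S) : Prop :=
  ∃ θs : List (Subst S), IsRefutation P A θs ∧ (Subst.compList θs).restrict A.FV = σ

end HOLP

-- Between truth in `minModel P` and refutability stands the big-step calculus `Prov`: existential
-- quantifiers are instantiated by explicit witnesses, and equations hold only between identical
-- terms. A logical relation leads from truth to provability, a lifting argument from provability to
-- refutations.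
--
-- Truth to provability. At type `o` a value is realized if its truth puts the empty argument list
-- into a given set; a function is realized if realized arguments give realized results; an
-- individual is realized by the term that names it. Realized values are closed under smaller values
-- and arbitrary suprema. Therefore few witnesses suffice for quantifiers over compact elements:
-- patterns test individual arguments for equality and ignore predicate arguments, the supremum of
-- their values is the top element, so a compact element lies below finitely many of these values
-- and is realized by a union of patterns (`exists_witness`). The fundamental lemma
-- `realizedBy_denote` follows by induction on expressions. Interpreting each predicate constant by
-- the supremum of the values it realizes gives a Herbrand model, again by the fundamental lemma, so
-- the smaller values in `minModel P` are realized too (`realizes_minModel`).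
--
-- A Herbrand state gives only ground terms to individual variables. Those of `A` are sent to
-- distinct constants outside `P` and `A`, and a map `κ`, built into the relation, reads these
-- constants back as the variables; predicate variables are sent to `⊥`, which everything realizes.
-- Truth under this single state proves `A` with its variables untouched (`prov_of_isTrue`).
--
-- Provability to refutations. If an instance of a formula under `θ` is provable, where `θ` takes
-- witnesses as values and fixes a set `X` of variables, then the formula has a refutation at least
-- as general as `θ` that also fixes `X`. This is an induction on the proof (`Prov.liftsRigid`,
-- `LiftsRigid.lifts`): a variable head is replaced by a template of which its value is an instance,
-- and equations are solved by mgus oriented so as to fix `X` (`hasMGU`). Taking the free variables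
-- of `A` for `X` and the identity for `θ` makes the computed answer the identity.

namespace HOLP

/-! ## Substitution calculus -/

instance isEmptyMemNil (ρ : ATy) : IsEmpty (Mem ρ []) := ⟨fun x => nomatch x⟩

theorem memNil_funext {α : ATy → Type} (b b' : ∀ ρ, Mem ρ [] → α ρ) : b = b' := by
  funext ρ x
  exact isEmptyElim x

namespace Expr

variable {S : Sig}

theorem liftRen_comp {Γ Δ Θ : List ATy} (r : ∀ ρ, Mem ρ Γ → Mem ρ Δ) (r' : ∀ ρ, Mem ρ Δ → Mem ρ Θ)
    {τ : ATy} :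
    (fun ρ (x : Mem ρ (τ :: Γ)) => liftRen r' (τ := τ) ρ (liftRen r ρ x)) =
      liftRen (fun ρ x => r' ρ (r ρ x)) := by
  funext ρ x
  cases x <;> rfl

theorem rename_rename {Γ : List ATy} {ρ : ATy} (E : Expr S Γ ρ) :
    ∀ {Δ Θ : List ATy} (r : ∀ ρ, Mem ρ Γ → Mem ρ Δ) (r' : ∀ ρ, Mem ρ Δ → Mem ρ Θ),
      (E.rename r).rename r' = E.rename fun ρ x => r' ρ (r ρ x) := by
  induction E with
  | func f ts ih => intro Δ Θ r r'; simp only [rename, ih]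
  | lam E ih => intro Δ Θ r r'; simp only [rename, ih, liftRen_comp]
  | ex E ih => intro Δ Θ r r'; simp only [rename, ih, liftRen_comp]
  | _ => intros; simp only [rename, *]

theorem liftB_liftRen {Γ Δ Θ : List ATy} (r : ∀ ρ, Mem ρ Γ → Mem ρ Δ)
    (b : ∀ ρ, Mem ρ Δ → Expr S Θ ρ) {τ : ATy} :
    (fun ρ (x : Mem ρ (τ :: Γ)) => liftB b (τ := τ) ρ (liftRen r ρ x)) =
      liftB (fun ρ x => b ρ (r ρ x)) := by
  funext ρ x
  cases x <;> rfl

theorem bind_rename {Γ : List ATy} {ρ : ATy} (E : Expr S Γ ρ) :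
    ∀ {Δ Θ : List ATy} (r : ∀ ρ, Mem ρ Γ → Mem ρ Δ) (b : ∀ ρ, Mem ρ Δ → Expr S Θ ρ)
      (f : ∀ ρ, ℕ → Expr S Θ ρ), (E.rename r).bind b f = E.bind (fun ρ x => b ρ (r ρ x)) f := by
  induction E with
  | func g ts ih => intro Δ Θ r b f; simp only [rename, bind, ih]
  | lam E ih => intro Δ Θ r b f; simp only [rename, bind, ih, liftB_liftRen]
  | ex E ih => intro Δ Θ r b f; simp only [rename, bind, ih, liftB_liftRen]
  | _ => intros; simp only [rename, bind, *]

theorem wk_rename {Γ Δ : List ATy} {ρ τ : ATy} (E : Expr S Γ ρ) (r : ∀ ρ, Mem ρ Γ → Mem ρ Δ) :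
    (E.wk (τ := τ)).rename (liftRen r) = (E.rename r).wk := by
  simp only [wk, rename_rename]
  rfl

theorem rename_liftB {Γ Δ Θ : List ATy} (b : ∀ ρ, Mem ρ Γ → Expr S Δ ρ)
    (r : ∀ ρ, Mem ρ Δ → Mem ρ Θ) {τ : ATy} :
    (fun ρ (x : Mem ρ (τ :: Γ)) => (liftB b (τ := τ) ρ x).rename (liftRen r)) =
      liftB (fun ρ x => (b ρ x).rename r) := by
  funext ρ x
  cases x with
  | zero => rfl
  | succ x => exact wk_rename _ _

theorem rename_bind {Γ : List ATy} {ρ : ATy} (E : Expr S Γ ρ) :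
    ∀ {Δ Θ : List ATy} (b : ∀ ρ, Mem ρ Γ → Expr S Δ ρ) (f : ∀ ρ, ℕ → Expr S Δ ρ)
      (r : ∀ ρ, Mem ρ Δ → Mem ρ Θ),
      (E.bind b f).rename r = E.bind (fun ρ x => (b ρ x).rename r) fun ρ n => (f ρ n).rename r := by
  induction E with
  | func g ts ih => intro Δ Θ b f r; simp only [rename, bind, ih]
  | lam E ih => intro Δ Θ b f r; simp only [rename, bind, ih, rename_liftB, wk_rename]
  | ex E ih => intro Δ Θ b f r; simp only [rename, bind, ih, rename_liftB, wk_rename]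
  | _ => intros; simp only [rename, bind, *]

theorem wk_bind {Γ Δ : List ATy} {ρ τ : ATy} (E : Expr S Γ ρ) (b : ∀ ρ, Mem ρ Γ → Expr S Δ ρ)
    (f : ∀ ρ, ℕ → Expr S Δ ρ) :
    (E.wk (τ := τ)).bind (liftB b) (fun ρ n => (f ρ n).wk) = (E.bind b f).wk := by
  simp only [wk, bind_rename, rename_bind]
  rfl

theorem bind_liftB {Γ Δ Θ : List ATy} (b : ∀ ρ, Mem ρ Γ → Expr S Δ ρ)
    (b' : ∀ ρ, Mem ρ Δ → Expr S Θ ρ) (f' : ∀ ρ, ℕ → Expr S Θ ρ) {τ : ATy} :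
    (fun ρ (x : Mem ρ (τ :: Γ)) => (liftB b (τ := τ) ρ x).bind (liftB b') fun ρ n => (f' ρ n).wk) =
      liftB (fun ρ x => (b ρ x).bind b' f') := by
  funext ρ x
  cases x with
  | zero => rfl
  | succ x => exact wk_bind _ _ _

theorem bind_bind {Γ : List ATy} {ρ : ATy} (E : Expr S Γ ρ) :
    ∀ {Δ Θ : List ATy} (b : ∀ ρ, Mem ρ Γ → Expr S Δ ρ) (f : ∀ ρ, ℕ → Expr S Δ ρ)
      (b' : ∀ ρ, Mem ρ Δ → Expr S Θ ρ) (f' : ∀ ρ, ℕ → Expr S Θ ρ),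
      (E.bind b f).bind b' f' =
        E.bind (fun ρ x => (b ρ x).bind b' f') fun ρ n => (f ρ n).bind b' f' := by
  induction E with
  | func g ts ih => intro Δ Θ b f b' f'; simp only [bind, ih]
  | lam E ih => intro Δ Θ b f b' f'; simp only [bind, ih, bind_liftB, wk_bind]
  | ex E ih => intro Δ Θ b f b' f'; simp only [bind, ih, bind_liftB, wk_bind]
  | _ => intros; simp only [bind, *]

theorem liftB_bvar {Γ : List ATy} {τ : ATy} :
    liftB (fun ρ (x : Mem ρ Γ) => (bvar x : Expr S Γ ρ)) (τ := τ) = fun _ x => bvar x := by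
  funext ρ x
  cases x <;> rfl

theorem bind_id {Γ : List ATy} {ρ : ATy} (E : Expr S Γ ρ) :
    E.bind (fun _ x => bvar x) (fun ρ n => fvar ρ n) = E := by
  induction E with
  | lam E ih => simp only [bind, liftB_bvar]; exact congrArg lam ih
  | ex E ih => simp only [bind, liftB_bvar]; exact congrArg ex ih
  | _ => simp only [bind, *]

theorem bind_congr {Γ : List ATy} {ρ : ATy} (E : Expr S Γ ρ) :
    ∀ {Δ : List ATy} (b : ∀ ρ, Mem ρ Γ → Expr S Δ ρ) {f f' : ∀ ρ, ℕ → Expr S Δ ρ},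
      (∀ v ∈ E.FV, f v.1 v.2 = f' v.1 v.2) → E.bind b f = E.bind b f' := by
  induction E with
  | fvar ρ n => intro Δ b f f' h; exact h (ρ, n) rfl
  | func g ts ih =>
    intro Δ b f f' h
    simp only [bind]
    congr 1
    funext j
    exact ih j b fun v hv => h v (Set.mem_iUnion.2 ⟨j, hv⟩)
  | lam E ih =>
    intro Δ b f f' h
    exact congrArg lam (ih _ fun v hv => congrArg wk (h v hv))
  | ex E ih =>
    intro Δ b f f' h
    exact congrArg ex (ih _ fun v hv => congrArg wk (h v hv))
  | app E₁ E₂ ih₁ ih₂ | and E₁ E₂ ih₁ ih₂ | or E₁ E₂ ih₁ ih₂ | eq E₁ E₂ ih₁ ih₂ =>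
    intro Δ b f f' h
    simp only [bind]
    rw [ih₁ b fun v hv => h v (Or.inl hv), ih₂ b fun v hv => h v (Or.inr hv)]
  | _ => intros; rfl

theorem FV_rename {Γ : List ATy} {ρ : ATy} (E : Expr S Γ ρ) :
    ∀ {Δ : List ATy} (r : ∀ ρ, Mem ρ Γ → Mem ρ Δ), (E.rename r).FV = E.FV := by
  induction E with
  | _ => intros; simp only [rename, FV, *]

theorem FV_bind_subset {Γ : List ATy} {ρ : ATy} (E : Expr S Γ ρ) :
    ∀ {Δ : List ATy} {b : ∀ ρ, Mem ρ Γ → Expr S Δ ρ} {f : ∀ ρ, ℕ → Expr S Δ ρ} {V : Set Var},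
      (∀ ρ x, (b ρ x).FV ⊆ V) → (∀ v ∈ E.FV, (f v.1 v.2).FV ⊆ V) → (E.bind b f).FV ⊆ V := by
  have lift : ∀ {Γ Δ : List ATy} {τ : ATy} {b : ∀ ρ, Mem ρ Γ → Expr S Δ ρ} {V : Set Var},
      (∀ ρ x, (b ρ x).FV ⊆ V) → ∀ ρ (x : Mem ρ (τ :: Γ)), (liftB b ρ x).FV ⊆ V := by
    intro Γ Δ τ b V h ρ x
    cases x with
    | zero => exact Set.empty_subset _
    | succ x => exact (FV_rename _ _).subset.trans (h _ x)
  induction E with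
  | fvar ρ n => intro Δ b f V hb hf; exact hf (ρ, n) rfl
  | bvar x => intro Δ b f V hb hf; exact hb _ x
  | func g ts ih =>
    intro Δ b f V hb hf
    exact Set.iUnion_subset fun j => ih j hb fun v hv => hf v (Set.mem_iUnion.2 ⟨j, hv⟩)
  | lam E ih | ex E ih =>
    intro Δ b f V hb hf
    exact ih (lift hb) fun v hv => (FV_rename _ _).subset.trans (hf v hv)
  | app E₁ E₂ ih₁ ih₂ | and E₁ E₂ ih₁ ih₂ | or E₁ E₂ ih₁ ih₂ | eq E₁ E₂ ih₁ ih₂ =>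
    intro Δ b f V hb hf
    exact Set.union_subset (ih₁ hb fun v hv => hf v (Or.inl hv))
      (ih₂ hb fun v hv => hf v (Or.inr hv))
  | _ => intros; exact Set.empty_subset _

theorem finite_FV {Γ : List ATy} {ρ : ATy} (E : Expr S Γ ρ) : E.FV.Finite := by
  induction E with
  | fvar ρ n => exact Set.finite_singleton _
  | func f ts ih => exact Set.finite_iUnion ih
  | lam E ih | ex E ih => exact ih
  | app E₁ E₂ ih₁ ih₂ | and E₁ E₂ ih₁ ih₂ | or E₁ E₂ ih₁ ih₂ | eq E₁ E₂ ih₁ ih₂ =>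
    exact ih₁.union ih₂
  | _ => exact Set.finite_empty

/-- `Eθ` for an arbitrary assignment `θ` of expressions to the variables. -/
def sub {ρ : ATy} (E : Expr S [] ρ) (θ : ∀ ρ, ℕ → Expr S [] ρ) : Expr S [] ρ :=
  E.bind (fun _ x => nomatch x) θ

theorem subst_eq_sub {ρ : ATy} (E : Expr S [] ρ) (θ : Subst S) : E.subst θ = E.sub θ.toFun := rfl

theorem sub_sub {ρ : ATy} (E : Expr S [] ρ) (θ σ : ∀ ρ, ℕ → Expr S [] ρ) :
    (E.sub θ).sub σ = E.sub fun ρ n => (θ ρ n).sub σ := by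
  unfold sub
  rw [bind_bind]
  congr 1
  exact memNil_funext _ _

theorem sub_fvar {ρ : ATy} (E : Expr S [] ρ) : E.sub (fun ρ n => fvar ρ n) = E := by
  conv_rhs => rw [← bind_id E]
  unfold sub
  congr 1
  exact memNil_funext _ _

theorem sub_congr {ρ : ATy} {E : Expr S [] ρ} {θ σ : ∀ ρ, ℕ → Expr S [] ρ}
    (h : ∀ v ∈ E.FV, θ v.1 v.2 = σ v.1 v.2) : E.sub θ = E.sub σ :=
  bind_congr E _ h

theorem sub_eq_self {ρ : ATy} {E : Expr S [] ρ} {θ : ∀ ρ, ℕ → Expr S [] ρ}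
    (h : ∀ v ∈ E.FV, θ v.1 v.2 = fvar v.1 v.2) : E.sub θ = E :=
  (sub_congr h).trans (sub_fvar E)

theorem FV_sub_subset {ρ : ATy} {E : Expr S [] ρ} {θ : ∀ ρ, ℕ → Expr S [] ρ} {V : Set Var}
    (h : ∀ v ∈ E.FV, (θ v.1 v.2).FV ⊆ V) : (E.sub θ).FV ⊆ V :=
  FV_bind_subset E (fun _ x => nomatch x) h

/-- Substitution in the scope of one binder. -/
def subUnder {τ ρ : ATy} (E : Expr S [τ] ρ) (θ : ∀ ρ, ℕ → Expr S [] ρ) : Expr S [τ] ρ :=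
  E.bind (liftB fun _ (x : Mem _ []) => nomatch x) fun ρ n => (θ ρ n).wk

theorem wk_bind_instB {τ ρ : ATy} (E : Expr S [] ρ) (E₁ : Expr S [] τ) :
    E.wk.bind (instB E₁) (fun ρ n => fvar ρ n) = E := by
  conv_rhs => rw [← sub_fvar E]
  unfold wk sub
  rw [bind_rename]
  congr 1

/-- Instantiating an index after a substitution amounts to one simultaneous substitution. -/
theorem inst_bind {Γ : List ATy} {τ ρ : ATy} (E : Expr S (τ :: Γ) ρ) (E₁ : Expr S [] τ)
    (b : ∀ ρ, Mem ρ Γ → Expr S [] ρ) (θ : ∀ ρ, ℕ → Expr S [] ρ)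
    (c : ∀ ρ, Mem ρ (τ :: Γ) → Expr S [] ρ) (h0 : c τ .zero = E₁)
    (hs : ∀ ρ x, c ρ (.succ x) = b ρ x) :
    (E.bind (liftB b) fun ρ n => (θ ρ n).wk).inst E₁ = E.bind c θ := by
  unfold inst
  rw [bind_bind]
  congr 1
  · funext ρ x
    cases x with
    | zero => exact h0.symm
    | succ x => exact (wk_bind_instB _ _).trans (hs _ x).symm
  · funext ρ n
    exact wk_bind_instB _ _

theorem inst_subUnder {τ ρ : ATy} (E : Expr S [τ] ρ) (E₁ : Expr S [] τ)
    (θ : ∀ ρ, ℕ → Expr S [] ρ) : (E.subUnder θ).inst E₁ = E.bind (instB E₁) θ :=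
  inst_bind E E₁ _ θ _ rfl fun _ x => isEmptyElim x

theorem sub_inst {τ ρ : ATy} (E : Expr S [τ] ρ) (E₁ : Expr S [] τ)
    (θ : ∀ ρ, ℕ → Expr S [] ρ) : (E.inst E₁).sub θ = (E.subUnder θ).inst (E₁.sub θ) := by
  rw [inst_subUnder]
  unfold inst sub
  rw [bind_bind]
  congr 1
  funext ρ x
  cases x with
  | zero => rfl
  | succ x => exact isEmptyElim x

end Expr

end HOLP

namespace HOLP

variable {S : Sig}

namespace Expr

theorem weaken_wk {ρ τ : ATy} (E : Expr S [] ρ) (Δ : List ATy) :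
    (E.weaken Δ).wk (τ := τ) = E.weaken (τ :: Δ) := by
  unfold weaken wk
  rw [rename_rename]
  congr 1
  exact memNil_funext _ _

theorem weaken_bind {ρ : ATy} (E : Expr S [] ρ) {Γ Δ : List ATy} (b : ∀ ρ, Mem ρ Γ → Expr S Δ ρ)
    (θ : ∀ ρ, ℕ → Expr S [] ρ) :
    (E.weaken Γ).bind b (fun ρ n => (θ ρ n).weaken Δ) = (E.sub θ).weaken Δ := by
  unfold weaken sub
  rw [bind_rename, rename_bind]
  congr 1
  exact memNil_funext _ _

theorem weaken_nil {ρ : ATy} (E : Expr S [] ρ) : E.weaken [] = E := by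
  unfold weaken
  rw [← bind_id (E.rename _), bind_rename]
  conv_rhs => rw [← sub_fvar E]
  unfold sub
  congr 1
  exact memNil_funext _ _

theorem bind_conj {Γ Δ : List ATy} (b : ∀ ρ, Mem ρ Γ → Expr S Δ ρ) (f : ∀ ρ, ℕ → Expr S Δ ρ) :
    ∀ l : List (Expr S Γ (.pred .o)), (conj l).bind b f = conj (l.map fun A => A.bind b f)
  | [] => rfl
  | [_] => rfl
  | A :: B :: l => congrArg (and (A.bind b f)) (bind_conj b f (B :: l))

theorem bind_disj {Γ Δ : List ATy} {π : PTy} (b : ∀ ρ, Mem ρ Γ → Expr S Δ ρ)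
    (f : ∀ ρ, ℕ → Expr S Δ ρ) : ∀ (l : List (Expr S Γ (.pred π))) (E : Expr S Γ (.pred π)),
      (disj E l).bind b f = disj (E.bind b f) (l.map fun A => A.bind b f)
  | [], _ => rfl
  | B :: l, E => congrArg (or (E.bind b f)) (bind_disj b f l B)

end Expr

/-! ## Patterns -/

/-- The tests `V₁ ≈ t₁ ∧ ⋯` on the individual arguments among `V₁, …, Vₙ`; no condition is put on
the predicate arguments. -/
inductive Pattern (S : Sig) : PTy → Type
  | nil : Pattern S .o
  | ind {π : PTy} (t : Expr S [] .i) (p : Pattern S π) : Pattern S (.arr .i π)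
  | any {π' π : PTy} (p : Pattern S π) : Pattern S (.arr (.pred π') π)

namespace Pattern

/-- The conditions of a pattern. -/
def toConds : {π : PTy} → Pattern S π → Conds S π
  | _, nil => .nil
  | _, ind t p => .cons (.eq t) p.toConds
  | _, any p => .cons .one p.toConds

/-- The terms in a pattern. -/
def terms : {π : PTy} → Pattern S π → List (Expr S [] .i)
  | _, nil => []
  | _, ind t p => t :: p.terms
  | _, any p => p.terms

/-- Substitution in the terms of a pattern. -/
def sub (θ : ∀ ρ, ℕ → Expr S [] ρ) : {π : PTy} → Pattern S π → Pattern S π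
  | _, nil => nil
  | _, ind t p => ind (t.sub θ) (p.sub θ)
  | _, any p => any (p.sub θ)

/-- The piece given by a pattern. -/
def toPiece {π : PTy} (p : Pattern S π) : Piece S π := .conds p.toConds

/-- The union of a nonempty list of patterns. -/
def union {π : PTy} (p : Pattern S π) (ps : List (Pattern S π)) : Expr S [] (.pred π) :=
  unionExpr p.toPiece (ps.map toPiece)

theorem sub_fvar {π : PTy} (p : Pattern S π) : p.sub (fun ρ n => .fvar ρ n) = p := by
  induction p with
  | nil => rfl
  | ind t p ih => simp only [sub, ih, Expr.sub_fvar]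
  | any p ih => simp only [sub, ih]

/-- The terms of a pattern mention no binder, so the substitution passes under the abstractions in
weakened form. The induction needs arbitrary conditions `acc` already collected. -/
theorem bind_abs (θ : ∀ ρ, ℕ → Expr S [] ρ) {π : PTy} (p : Pattern S π) :
    ∀ {Γ Δ : List ATy} (b : ∀ ρ, Mem ρ Γ → Expr S Δ ρ) (acc : List (Expr S Γ (.pred .o))),
      (p.toConds.abs acc).bind b (fun ρ n => (θ ρ n).weaken Δ) =
        (p.sub θ).toConds.abs (acc.map fun A => A.bind b fun ρ n => (θ ρ n).weaken Δ) := by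
  have lift : ∀ {Γ Δ : List ATy} {τ : ATy} (b : ∀ ρ, Mem ρ Γ → Expr S Δ ρ)
      (acc : List (Expr S Γ (.pred .o))),
      (acc.map Expr.wk).map (fun A => A.bind (Expr.liftB b (τ := τ))
        fun ρ n => (θ ρ n).weaken (τ :: Δ)) =
      (acc.map fun A => A.bind b fun ρ n => (θ ρ n).weaken Δ).map Expr.wk := by
    intro Γ Δ τ b acc
    rw [List.map_map, List.map_map]
    refine List.map_congr_left fun A _ => ?_
    have h := Expr.wk_bind (τ := τ) A b fun ρ n => (θ ρ n).weaken Δ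
    simp only [Expr.weaken_wk] at h
    exact h
  induction p with
  | nil => intro Γ Δ b acc; exact Expr.bind_conj _ _ _
  | ind t p ih =>
    intro Γ Δ b acc
    simp only [toConds, Conds.abs, sub, Expr.bind, Expr.weaken_wk, ih, List.map_append, lift]
    simp only [List.map_cons, List.map_nil, Cond.toExpr, Expr.bind, Expr.weaken_bind, Expr.liftB]
  | any p ih =>
    intro Γ Δ b acc
    simp only [toConds, Conds.abs, sub, Expr.bind, Expr.weaken_wk, ih, List.map_append, lift]
    simp only [List.map_cons, List.map_nil, Cond.toExpr, Expr.bind]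

theorem sub_toExpr (θ : ∀ ρ, ℕ → Expr S [] ρ) {π : PTy} (p : Pattern S π) :
    p.toPiece.toExpr.sub θ = (p.sub θ).toPiece.toExpr := by
  have h := p.bind_abs θ (Γ := []) (Δ := []) (fun _ x => nomatch x) []
  simp only [Expr.weaken_nil] at h
  exact h

theorem sub_union (θ : ∀ ρ, ℕ → Expr S [] ρ) {π : PTy} (p : Pattern S π)
    (ps : List (Pattern S π)) : (p.union ps).sub θ = (p.sub θ).union (ps.map (sub θ)) := by
  refine (Expr.bind_disj _ _ _ _).trans ?_
  unfold union unionExpr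
  simp only [List.map_map]
  congr 1
  · exact p.sub_toExpr θ
  · exact List.map_congr_left fun q _ => q.sub_toExpr θ

theorem subexprs_toPiece {π : PTy} (p : Pattern S π) :
    p.toPiece.subexprs = p.terms.map fun t => ⟨.i, t⟩ := by
  change p.toConds.subexprs = _
  induction p with
  | nil => rfl
  | ind t p ih => simp only [toConds, Conds.subexprs, Cond.subexprs, ih, terms]; rfl
  | any p ih => simp only [toConds, Conds.subexprs, Cond.subexprs, ih, terms]; rfl

theorem flatMap_subexprs {π : PTy} (ps : List (Pattern S π)) :
    (ps.map toPiece).flatMap Piece.subexprs =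
      (ps.flatMap terms).map fun t => (⟨.i, t⟩ : Σ ρ, Expr S [] ρ) := by
  induction ps with
  | nil => rfl
  | cons p ps ih =>
    rw [List.map_cons, List.flatMap_cons, ih, subexprs_toPiece, List.flatMap_cons, List.map_append]

/-- An argument list that passes the tests of a pattern. -/
inductive Matches : {π : PTy} → Pattern S π → Args S π → Prop
  | nil : Matches nil .nil
  | ind {π : PTy} (t : Expr S [] .i) {p : Pattern S π} {as : Args S π} (h : Matches p as) :
      Matches (ind t p) (.cons t as)
  | any {π' π : PTy} (E : Expr S [] (.pred π')) {p : Pattern S π} {as : Args S π}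
      (h : Matches p as) : Matches (any p) (.cons E as)

end Pattern

/-- The basic expressions that suffice as witnesses of existential quantifiers, together with the
variables. -/
inductive IsWitness : {ρ : ATy} → Expr S [] ρ → Prop
  | term (t : Expr S [] .i) : IsWitness t
  | var (π : PTy) (n : ℕ) : IsWitness (.fvar (.pred π) n)
  | one : IsWitness (.top : Expr S [] (.pred .o))
  | union {ρ : ATy} {π : PTy} (p : Pattern S (.arr ρ π)) (ps : List (Pattern S (.arr ρ π))) :
      IsWitness (p.union ps)

theorem IsWitness.fvar (ρ : ATy) (n : ℕ) : IsWitness (.fvar ρ n : Expr S [] ρ) := by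
  cases ρ with
  | i => exact .term _
  | pred π => exact .var π n

/-! ## Provability -/

/-- `Prov P E as`: the formula `E E₁ ⋯ Eₙ`, with arguments `as`, succeeds when the existential
quantifiers are instantiated by witnesses and equations hold syntactically. -/
inductive Prov (P : Program S) : {π : PTy} → Expr S [] (.pred π) → Args S π → Prop
  | app {ρ : ATy} {π : PTy} {E₁ : Expr S [] (.pred (.arr ρ π))} {E₂ : Expr S [] ρ} {as : Args S π}
      (h : Prov P E₁ (.cons E₂ as)) : Prov P (.app E₁ E₂) as
  | clause (cl : Clause S) (hcl : cl ∈ P) {as : Args S cl.type} (h : Prov P cl.body as) :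
      Prov P (.pconst cl.head) as
  | beta {ρ : ATy} {π : PTy} {E : Expr S [ρ] (.pred π)} {E₁ : Expr S [] ρ} {as : Args S π}
      (h : Prov P (E.inst E₁) as) : Prov P (.lam E) (.cons E₁ as)
  | orLeft {π : PTy} {E' E'' : Expr S [] (.pred π)} {as : Args S π} (h : Prov P E' as) :
      Prov P (.or E' E'') as
  | orRight {π : PTy} {E' E'' : Expr S [] (.pred π)} {as : Args S π} (h : Prov P E'' as) :
      Prov P (.or E' E'') as
  | and {π : PTy} {E' E'' : Expr S [] (.pred π)} {as : Args S π} (h' : Prov P E' as)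
      (h'' : Prov P E'' as) : Prov P (.and E' E'') as
  | top : Prov P .top .nil
  | eq (t : Expr S [] .i) : Prov P (.eq t t) .nil
  | ex {ρ : ATy} {E : Expr S [ρ] (.pred .o)} {B : Expr S [] ρ} (hB : IsWitness B)
      (h : Prov P (E.inst B) .nil) : Prov P (.ex E) .nil

variable {P : Program S}

theorem Prov.conj : ∀ {l : List (Expr S [] (.pred .o))}, (∀ A ∈ l, Prov P A .nil) →
    Prov P (Expr.conj l) .nil
  | [], _ => .top
  | [_], h => h _ List.mem_cons_self
  | _ :: _ :: _, h => .and (h _ List.mem_cons_self)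
      (Prov.conj fun A hA => h A (List.mem_cons_of_mem _ hA))

theorem Prov.disj {π : PTy} {as : Args S π} {F : Expr S [] (.pred π)} (hF : Prov P F as) :
    ∀ {l : List (Expr S [] (.pred π))} {E : Expr S [] (.pred π)}, F ∈ E :: l →
      Prov P (Expr.disj E l) as
  | [], E, h => by rw [List.mem_singleton] at h; exact h ▸ hF
  | B :: l, E, h => by
    rcases List.mem_cons.1 h with rfl | h
    · exact .orLeft hF
    · exact .orRight (Prov.disj hF h)

/-- The conditions collected earlier are weakened and so ignore the argument; only the newest
condition receives it. -/
theorem Pattern.inst_abs {τ : ATy} {π : PTy} (p : Pattern S π)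
    (acc : List (Expr S [] (.pred .o))) (A : Expr S [τ] (.pred .o)) (E : Expr S [] τ) :
    (p.toConds.abs (acc.map Expr.wk ++ [A])).inst E = p.toConds.abs (acc ++ [A.inst E]) := by
  refine (p.bind_abs (fun ρ n => .fvar ρ n) (Δ := []) (Expr.instB E) _).trans ?_
  rw [Pattern.sub_fvar, List.map_append, List.map_map]
  congr 2
  conv_rhs => rw [← List.map_id acc]
  exact List.map_congr_left fun B _ => Expr.wk_bind_instB B E

/-- Each argument is consumed by a beta rule that turns its test into `t ≈ t` or `1`, so the
collected conditions are all provable once the arguments are exhausted. -/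
theorem Pattern.Matches.prov {π : PTy} {p : Pattern S π} {as : Args S π} (h : p.Matches as) :
    ∀ {acc : List (Expr S [] (.pred .o))}, (∀ A ∈ acc, Prov P A .nil) →
      Prov P (p.toConds.abs acc) as := by
  induction h with
  | nil => intro acc hacc; exact .conj hacc
  | @ind π t p as h ih =>
    intro acc hacc
    refine .beta ?_
    rw [Pattern.inst_abs]
    refine ih fun A hA => ?_
    rcases List.mem_append.1 hA with hA | hA
    · exact hacc A hA
    · rw [List.mem_singleton.1 hA]
      change Prov P (.eq t ((t.weaken [.i]).inst t)) .nil
      have ht : (t.weaken [.i]).inst t = t :=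
        (Expr.weaken_bind (Δ := []) t (Expr.instB t) fun ρ n => .fvar ρ n).trans
          ((Expr.weaken_nil _).trans (Expr.sub_fvar t))
      rw [ht]
      exact .eq t
  | @any π' π E p as h ih =>
    intro acc hacc
    refine .beta ?_
    rw [Pattern.inst_abs]
    refine ih fun A hA => ?_
    rcases List.mem_append.1 hA with hA | hA
    · exact hacc A hA
    · rw [List.mem_singleton.1 hA]
      exact .top

theorem Pattern.Matches.prov_union {π : PTy} {p q : Pattern S π} {qs : List (Pattern S π)}
    {as : Args S π} (h : p.Matches as) (hp : p ∈ q :: qs) : Prov P (q.union qs) as := by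
  have hF : Prov P p.toPiece.toExpr as := h.prov (acc := []) (by simp)
  refine hF.disj ?_
  rw [List.map_map]
  exact List.mem_map_of_mem (f := fun q : Pattern S π => q.toPiece.toExpr) hp

end HOLP

namespace HOLP

variable {S : Sig}

/-! ## A logical relation between values and expressions -/

/-- The term for an element of the Herbrand universe, with `κ c` in place of the constant `c`. -/
def GTerm.toExpr (κ : S.Const → Expr S [] .i) : GTerm S → Expr S [] .i
  | const c => κ c
  | func f ts => .func f fun j => (ts j).toExpr κ

mutual
  /-- The value `d` is realized by the set `K` of argument lists: if `d` is true at some basic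
  elements, then `K` contains all lists of expressions that realize these elements. -/
  def Realizes (P : Program S) (κ : S.Const → Expr S [] .i) :
      (π : PTy) → SemP (GTerm S) π → (Args S π → Prop) → Prop
    | .o, d, K => (show Prop from d) → K .nil
    | .arr ρ π, f, K => ∀ (b : Basis (GTerm S) ρ) (E : Expr S [] ρ),
        RealizedBy P κ ρ (basisIncl (GTerm S) ρ b) E →
          Realizes P κ π (toHom f b) fun as => K (.cons E as)
  /-- The value of an argument type is realized by an expression. -/
  def RealizedBy (P : Program S) (κ : S.Const → Expr S [] .i) :
      (ρ : ATy) → SemA (GTerm S) ρ → Expr S [] ρ → Prop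
    | .i, g, t => GTerm.toExpr κ g = t
    | .pred π, d, E => Realizes P κ π d (Prov P E)
end

variable {P : Program S} {κ : S.Const → Expr S [] .i}

theorem Realizes.mono : ∀ {π : PTy} {d : SemP (GTerm S) π} {K K' : Args S π → Prop},
    Realizes P κ π d K → (∀ as, K as → K' as) → Realizes P κ π d K'
  | .o, _, _, _, h, hK => fun hd => hK _ (h hd)
  | .arr _ _, _, _, _, h, hK => fun b E hb => (h b E hb).mono fun _ => hK _

theorem Realizes.anti : ∀ {π : PTy} {d d' : SemP (GTerm S) π} {K : Args S π → Prop},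
    Realizes P κ π d K → d' ≤ d → Realizes P κ π d' K
  | .o, _, _, _, h, hd => fun hd' => h (hd hd')
  | .arr _ _, _, _, _, h, hd => fun b E hb => (h b E hb).anti (hd b)

theorem RealizedBy.anti : ∀ {ρ : ATy} {a a' : SemA (GTerm S) ρ} {E : Expr S [] ρ},
    RealizedBy P κ ρ a E → a' ≤ a → RealizedBy P κ ρ a' E
  | .i, a, a', _, h, ha => (congrArg (GTerm.toExpr κ) (show a' = a from ha)).trans h
  | .pred _, _, _, _, h, ha => Realizes.anti h ha

/-- Suprema are pointwise, and at type `o` a supremum is true only if some member is. With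
`Realizes.anti`, the values realized by a fixed `K` are those below a largest one. -/
theorem Realizes.iSup : ∀ {π : PTy} {ι : Sort*} {d : ι → SemP (GTerm S) π}
    {K : Args S π → Prop}, (∀ i, Realizes P κ π (d i) K) → Realizes P κ π (⨆ i, d i) K
  | .o, _, d, _, h => fun hd => by
    obtain ⟨i, hi⟩ := iSup_Prop_eq.mp hd
    exact h i hi
  | .arr ρ π, _, d, _, h => fun b E hb => by
    refine (Realizes.iSup fun i => h i b E hb).anti (le_of_eq ?_)
    exact OrderHom.iSup_apply (β := SemP (GTerm S) π) d b

theorem Realizes.inf : ∀ {π : PTy} {d d' : SemP (GTerm S) π}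
    {K K' : Args S π → Prop}, Realizes P κ π d K → Realizes P κ π d' K' →
      Realizes P κ π (d ⊓ d') fun as => K as ∧ K' as
  | .o, _, _, _, _, h, h' => fun hd => ⟨h hd.1, h' hd.2⟩
  | .arr _ _, _, _, _, _, h, h' => fun b E hb => (h b E hb).inf (h' b E hb)

theorem Realizes.sup {π : PTy} {d d' : SemP (GTerm S) π}
    {K : Args S π → Prop} (h : Realizes P κ π d K) (h' : Realizes P κ π d' K) :
      Realizes P κ π (d ⊔ d') K := by
  rw [sup_eq_iSup]
  exact .iSup fun i => by cases i <;> assumption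

theorem Realizes.bot : ∀ {π : PTy} {K : Args S π → Prop}, Realizes P κ π ⊥ K
  | .o, _ => fun hd => hd.elim
  | .arr _ _, _ => fun _ _ _ => Realizes.bot

/-! ## Compact elements are realized by witnesses -/

/-- The largest value that a pattern realizes. -/
noncomputable def Pattern.value (κ : S.Const → Expr S [] .i) :
    {π : PTy} → Pattern S π → SemP (GTerm S) π
  | _, nil => True
  | _, .ind (π := π) t p =>
    (⟨fun g => ⨆ _ : GTerm.toExpr κ g = t, p.value κ, fun g g' h => by
      cases (show g = g' from h); exact le_rfl⟩ : Basis (GTerm S) .i →o SemP (GTerm S) π)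
  | _, .any (π' := π') (π := π) p =>
    (⟨fun _ => p.value κ, fun _ _ _ => le_rfl⟩ : Basis (GTerm S) (.pred π') →o SemP (GTerm S) π)

theorem Pattern.realizes_value {π : PTy} (p : Pattern S π) :
    Realizes P κ π (p.value κ) p.Matches := by
  induction p with
  | nil => exact fun _ => .nil
  | ind t p ih =>
    intro g E hE
    cases (show GTerm.toExpr κ g = E from hE)
    change Realizes P κ _ (⨆ _ : GTerm.toExpr κ g = t, p.value κ) _
    exact Realizes.iSup fun h => ih.mono fun as has => h ▸ .ind _ has
  | any p ih => exact fun b E _ => ih.mono fun as has => .any E has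

/-- At an individual argument `g`, the pattern that tests for the name of `g` takes the value of its
tail. Hence at every argument the supremum is at least the one for the result type. -/
theorem Pattern.top_le_iSup_value : ∀ π : PTy,
    (⊤ : SemP (GTerm S) π) ≤ ⨆ p : Pattern S π, p.value κ
  | .o => fun _ => (le_iSup (fun p : Pattern S .o => p.value κ) .nil : (True : Prop) ≤ _) trivial
  | .arr .i π => fun g => by
    have h : (⨆ p : Pattern S π, p.value κ) ≤
        ⨆ p : Pattern S (.arr .i π), toHom (p.value κ) g := by
      refine iSup_le fun p => le_trans ?_ (le_iSup _ (.ind (GTerm.toExpr κ g) p))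
      exact le_iSup (fun _ : GTerm.toExpr κ g = GTerm.toExpr κ g => p.value κ) rfl
    refine ((Pattern.top_le_iSup_value π).trans h).trans (le_of_eq ?_)
    exact (OrderHom.iSup_apply (β := SemP (GTerm S) π) _ g).symm
  | .arr (.pred π') π => fun b => by
    have h : (⨆ p : Pattern S π, p.value κ) ≤
        ⨆ p : Pattern S (.arr (.pred π') π), toHom (p.value κ) b :=
      iSup_le fun p => le_iSup (fun p : Pattern S (.arr (.pred π') π) => toHom (p.value κ) b)
        (.any p)
    refine ((Pattern.top_le_iSup_value π).trans h).trans (le_of_eq ?_)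
    exact (OrderHom.iSup_apply (β := SemP (GTerm S) π) _ b).symm

/-- Some pattern of each type. -/
def Pattern.default : (π : PTy) → Pattern S π
  | .o => .nil
  | .arr .i π => .ind (.fvar .i 0) (Pattern.default π)
  | .arr (.pred _) π => .any (Pattern.default π)

/-- An upper bound of `b` is enough, since realizability passes to smaller values; the witness need
not denote `b`. Compactness makes the union finite. -/
theorem exists_witness (ρ : ATy) (b : Basis (GTerm S) ρ) :
    ∃ B : Expr S [] ρ, IsWitness B ∧ RealizedBy P κ ρ (basisIncl (GTerm S) ρ b) B := by
  cases ρ with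
  | i => exact ⟨_, .term _, rfl⟩
  | pred π =>
    cases π with
    | o => exact ⟨.top, .one, fun _ => Prov.top⟩
    | arr ρ π =>
      obtain ⟨s, hs⟩ := CompleteLattice.IsCompactElement.exists_finset_of_le_iSup
        (α := SemP (GTerm S) (.arr ρ π)) b.2 (fun p : Pattern S (.arr ρ π) => p.value κ)
        (le_top.trans (Pattern.top_le_iSup_value _))
      -- A union must be nonempty and the finite set may be empty; the default pattern fills the gap
      -- and can only make more argument lists provable.
      refine ⟨(Pattern.default _).union s.toList, .union _ _, ?_⟩
      refine Realizes.anti ?_ hs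
      refine Realizes.iSup fun p => Realizes.iSup fun hp => p.realizes_value.mono fun as has => ?_
      exact has.prov_union (List.mem_cons_of_mem _ (Finset.mem_toList.2 hp))

/-! ## The fundamental lemma -/

/-- Each clause of the denotation is matched by a rule of `Prov`. Only the existential quantifier
requires an expression to be invented, and `exists_witness` supplies it. -/
theorem realizedBy_denote [Nonempty S.Const] (I : HInterp S)
    (hI : ∀ π p, Realizes P κ π (I π p) (Prov P (.pconst p)))
    {Γ : List ATy} {ρ : ATy} (E : Expr S Γ ρ) (hκ : ∀ c ∈ E.consts, κ c = .const c) :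
    ∀ (e : Env (GTerm S) Γ) (b : ∀ ρ, Mem ρ Γ → Expr S [] ρ) (θ : ∀ ρ, ℕ → Expr S [] ρ),
      (∀ ρ x, RealizedBy P κ ρ (basisIncl (GTerm S) ρ (e.1 ρ x)) (b ρ x)) →
      (∀ v ∈ E.FV, RealizedBy P κ v.1 (basisIncl (GTerm S) v.1 (e.2 v.1 v.2)) (θ v.1 v.2)) →
      RealizedBy P κ ρ (E.denote I.toInterp e) (E.bind b θ) := by
  have hcons : ∀ {Γ : List ATy} {τ : ATy} {e : Env (GTerm S) Γ} {b : ∀ ρ, Mem ρ Γ → Expr S [] ρ}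
      {d : Basis (GTerm S) τ} {B : Expr S [] τ},
      (∀ ρ x, RealizedBy P κ ρ (basisIncl (GTerm S) ρ (e.1 ρ x)) (b ρ x)) →
      RealizedBy P κ τ (basisIncl (GTerm S) τ d) B →
      ∃ c : ∀ ρ, Mem ρ (τ :: Γ) → Expr S [] ρ, c τ .zero = B ∧ (∀ ρ x, c ρ (.succ x) = b ρ x) ∧
        ∀ ρ x, RealizedBy P κ ρ (basisIncl (GTerm S) ρ ((e.cons d).1 ρ x)) (c ρ x) := by
    intro Γ τ e b d B hb hB
    refine ⟨fun ρ x => match ρ, x with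
      | _, .zero => B
      | _, .succ x => b _ x, rfl, fun _ _ => rfl, fun ρ x => ?_⟩
    cases x with
    | zero => exact hB
    | succ x => exact hb _ x
  induction E with
  | fvar ρ n => intro e b θ hb hθ; exact hθ (ρ, n) rfl
  | bvar x => intro e b θ hb hθ; exact hb _ x
  | const c => intro e b θ hb hθ; exact hκ c rfl
  | func f ts ih =>
    intro e b θ hb hθ
    exact congrArg (Expr.func f) (funext fun j =>
      ih j (fun c hc => hκ c (Set.mem_iUnion.2 ⟨j, hc⟩)) e b θ hb
        fun v hv => hθ v (Set.mem_iUnion.2 ⟨j, hv⟩))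
  | pconst p => intro e b θ hb hθ; exact hI _ p
  | bot => intro e b θ hb hθ; exact fun h => h.elim
  | top => intro e b θ hb hθ; exact fun _ => Prov.top
  | app E₁ E₂ ih₁ ih₂ =>
    intro e b θ hb hθ
    -- The value is a supremum over basic elements below the argument, and the instance of `E₂`
    -- realizes each of them by `RealizedBy.anti`.
    refine Realizes.iSup fun d => ?_
    have h₁ := ih₁ (fun c hc => hκ c (Or.inl hc)) e b θ hb fun v hv => hθ v (Or.inl hv)
    have h₂ := ih₂ (fun c hc => hκ c (Or.inr hc)) e b θ hb fun v hv => hθ v (Or.inr hv)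
    exact (h₁ d.1 _ (h₂.anti d.2)).mono fun as h => .app h
  | lam E ih =>
    intro e b θ hb hθ d B hB
    obtain ⟨c, hc0, hcs, hc⟩ := hcons hb hB
    refine Realizes.mono (ih hκ (e.cons d) c θ hc hθ) fun as h => .beta ?_
    rwa [Expr.inst_bind E B b θ c hc0 hcs]
  | and E₁ E₂ ih₁ ih₂ =>
    intro e b θ hb hθ
    have h₁ := ih₁ (fun c hc => hκ c (Or.inl hc)) e b θ hb fun v hv => hθ v (Or.inl hv)
    have h₂ := ih₂ (fun c hc => hκ c (Or.inr hc)) e b θ hb fun v hv => hθ v (Or.inr hv)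
    exact (Realizes.inf h₁ h₂).mono fun as h => .and h.1 h.2
  | or E₁ E₂ ih₁ ih₂ =>
    intro e b θ hb hθ
    have h₁ := ih₁ (fun c hc => hκ c (Or.inl hc)) e b θ hb fun v hv => hθ v (Or.inl hv)
    have h₂ := ih₂ (fun c hc => hκ c (Or.inr hc)) e b θ hb fun v hv => hθ v (Or.inr hv)
    exact Realizes.sup (Realizes.mono h₁ fun as h => .orLeft h)
      (Realizes.mono h₂ fun as h => .orRight h)
  | eq E₁ E₂ ih₁ ih₂ =>
    intro e b θ hb hθ
    have h₁ := ih₁ (fun c hc => hκ c (Or.inl hc)) e b θ hb fun v hv => hθ v (Or.inl hv)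
    have h₂ := ih₂ (fun c hc => hκ c (Or.inr hc)) e b θ hb fun v hv => hθ v (Or.inr hv)
    intro h
    -- Both instances are the name of the same ground term, so they coincide as expressions.
    have h₃ : E₁.bind b θ = E₂.bind b θ :=
      (Eq.symm h₁).trans ((congrArg (GTerm.toExpr κ) h).trans h₂)
    change Prov P (.eq (E₁.bind b θ) (E₂.bind b θ)) .nil
    rw [h₃]
    exact .eq _
  | ex E ih =>
    intro e b θ hb hθ h
    obtain ⟨d, hd⟩ := h
    obtain ⟨B, hB, hdB⟩ := exists_witness (P := P) (κ := κ) _ d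
    obtain ⟨c, hc0, hcs, hc⟩ := hcons hb hdB
    refine .ex hB ?_
    rw [Expr.inst_bind E B b θ c hc0 hcs]
    exact ih hκ (e.cons d) c θ hc hθ hd

/-- The values of the minimum model are realized by the predicate constants. -/
theorem realizes_minModel [Nonempty S.Const]
    (hκ : ∀ cl ∈ P, ∀ c ∈ cl.body.consts, κ c = .const c) (π : PTy) (p : S.Pred π) :
    Realizes P κ π (minModel P π p) (Prov P (.pconst p)) := by
  -- The largest interpretation whose values are realized by the predicate constants.
  let I : HInterp S := fun π p =>
    ⨆ d : {d : SemP (GTerm S) π // Realizes P κ π d (Prov P (.pconst p))}, d.1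
  have hI : ∀ π p, Realizes P κ π (I π p) (Prov P (.pconst p)) := fun π p =>
    Realizes.iSup fun d => d.2
  have hmodel : I.toInterp.IsModel P := by
    intro cl hcl s
    have h := realizedBy_denote I hI cl.body (hκ cl hcl) ((fun _ x => nomatch x), s)
      (fun _ x => nomatch x) (fun ρ n => .fvar ρ n) (fun _ x => nomatch x)
      (fun v hv => by rw [cl.closed] at hv; exact hv.elim)
    -- The value of the body is itself a member of the supremum defining `I` at the head: a proof of
    -- the body gives a proof of the head by the clause rule.
    refine le_iSup (fun d : {d : SemP (GTerm S) cl.type //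
      Realizes P κ cl.type d (Prov P (.pconst cl.head))} => d.1) ⟨_, ?_⟩
    refine Realizes.mono h fun as has => .clause cl hcl ?_
    change Prov P (cl.body.sub _) as at has
    rwa [Expr.sub_fvar] at has
  exact (hI π p).anti ((sInf_le hmodel : minModel P ≤ I) π p)

end HOLP

namespace HOLP

variable {S : Sig}

/-! ## Unification -/

namespace Subst

theorem single_self (ρ : ATy) (n : ℕ) (E : Expr S [] ρ) : (single ρ n E).toFun ρ n = E :=
  dif_pos ⟨rfl, rfl⟩

theorem single_of_ne {ρ τ : ATy} {m n : ℕ} (E : Expr S [] τ) (h : ((ρ, n) : Var) ≠ (τ, m)) :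
    (single τ m E).toFun ρ n = .fvar ρ n :=
  dif_neg fun h' => h (Prod.ext h'.1.symm h'.2.symm)

theorem single_sub {τ : ATy} {m : ℕ} {E : Expr S [] τ} {σ : ∀ ρ, ℕ → Expr S [] ρ}
    (h : E.sub σ = σ τ m) (ρ : ATy) (n : ℕ) : ((single τ m E).toFun ρ n).sub σ = σ ρ n := by
  by_cases hv : ((ρ, n) : Var) = (τ, m)
  · cases hv
    rw [single_self, h]
  · rw [single_of_ne E hv]
    rfl

theorem isZeroOrder_iff {θ : Subst S} :
    θ.IsZeroOrder ↔ ∀ ρ n, ρ ≠ .i → θ.toFun ρ n = .fvar ρ n := by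
  constructor
  · intro h ρ n hρ
    by_contra hne
    exact hρ (h (ρ, n) hne)
  · intro h v hv
    by_contra hne
    exact hv (h _ _ hne)

end Subst

-- Terms and the occurs check

namespace Expr

/-- The induction principle of the indexed family requires free indices; the empty context and the
type of individuals are restored through equations. -/
theorem term_induction {motive : Expr S [] .i → Prop} (fvar : ∀ n, motive (fvar .i n))
    (const : ∀ c, motive (const c))
    (func : ∀ (n : ℕ) (f : S.Func n) (ts : Fin (n + 1) → Expr S [] .i), (∀ j, motive (ts j)) →
      motive (func f ts)) (t : Expr S [] .i) : motive t := by
  have key : ∀ {Γ : List ATy} {ρ : ATy} (E : Expr S Γ ρ) (hΓ : Γ = []) (hρ : ρ = .i),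
      motive (hρ ▸ hΓ ▸ E) := by
    intro Γ ρ E
    induction E with
    | fvar ρ n => rintro rfl rfl; exact fvar n
    | bvar x => rintro rfl rfl; exact isEmptyElim x
    | const c => rintro rfl _; exact const c
    | func f ts ih => rintro rfl _; exact func _ f ts fun j => ih j rfl rfl
    | _ => intro _ h; cases h
  exact key t rfl rfl

/-- The number of symbols of a term. -/
def size : {Γ : List ATy} → {ρ : ATy} → Expr S Γ ρ → ℕ
  | _, _, func _ ts => 1 + ∑ j, (ts j).size
  | _, _, _ => 1

theorem size_pos {Γ : List ATy} {ρ : ATy} (E : Expr S Γ ρ) : 0 < E.size := by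
  cases E <;> simp [size]

theorem size_le_size_sub (θ : ∀ ρ, ℕ → Expr S [] ρ) (n : ℕ) (t : Expr S [] .i) :
    (.i, n) ∈ t.FV → (θ .i n).size ≤ (t.sub θ).size := by
  induction t using term_induction with
  | fvar m => intro h; cases h; exact le_rfl
  | const c => intro h; exact h.elim
  | func k f ts ih =>
    intro h
    obtain ⟨j, hj⟩ := Set.mem_iUnion.1 h
    have h₁ : ((ts j).sub θ).size ≤ ∑ j, ((ts j).sub θ).size :=
      Finset.single_le_sum (f := fun j => ((ts j).sub θ).size) (fun _ _ => Nat.zero_le _)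
        (Finset.mem_univ j)
    exact (ih j hj).trans (h₁.trans (Nat.le_add_left _ 1))

/-- Otherwise the value of the variable would be a proper part of itself, which its size forbids. -/
theorem not_mem_FV_of_sub_eq_func {θ : ∀ ρ, ℕ → Expr S [] ρ} {n k : ℕ} {f : S.Func k}
    {ts : Fin (k + 1) → Expr S [] .i} (h : θ .i n = (func f ts).sub θ) :
    ((.i, n) : Var) ∉ (func f ts).FV := by
  intro hn
  obtain ⟨j, hj⟩ := Set.mem_iUnion.1 hn
  have h₁ : ((ts j).sub θ).size ≤ ∑ j, ((ts j).sub θ).size :=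
    Finset.single_le_sum (f := fun j => ((ts j).sub θ).size) (fun _ _ => Nat.zero_le _)
      (Finset.mem_univ j)
  have h₂ := size_le_size_sub θ n (ts j) hj
  have h₃ : (θ .i n).size = 1 + ∑ j, ((ts j).sub θ).size := congrArg size h
  omega

end Expr

-- Most general solutions of systems of equations

/-- `θ` solves all equations of a list. -/
def Unifies (θ : ∀ ρ, ℕ → Expr S [] ρ) (l : List (Expr S [] .i × Expr S [] .i)) : Prop :=
  ∀ e ∈ l, e.1.sub θ = e.2.sub θ

/-- The variables of a list of equations. -/
def eqnVars (l : List (Expr S [] .i × Expr S [] .i)) : Set Var :=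
  {v | ∃ e ∈ l, v ∈ e.1.FV ∪ e.2.FV}

/-- The size of a list of equations. -/
def eqnSize (l : List (Expr S [] .i × Expr S [] .i)) : ℕ := (l.map fun e => e.1.size).sum

/-- If the equations have a solution that fixes the variables in `X`, then they have an idempotent
most general solution that fixes the variables in `X`. -/
def HasMGU (X : Set Var) (l : List (Expr S [] .i × Expr S [] .i)) : Prop :=
  ∀ τ : ∀ ρ, ℕ → Expr S [] ρ, (∀ v ∈ X, τ v.1 v.2 = .fvar v.1 v.2) → Unifies τ l →
    ∃ μ : Subst S, μ.IsZeroOrder ∧ Unifies μ.toFun l ∧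
      (∀ v ∈ X, μ.toFun v.1 v.2 = .fvar v.1 v.2) ∧
      ∀ σ, Unifies σ l → ∀ ρ n, (μ.toFun ρ n).sub σ = σ ρ n

variable {X : Set Var} {l : List (Expr S [] .i × Expr S [] .i)}

theorem finite_eqnVars (l : List (Expr S [] .i × Expr S [] .i)) : (eqnVars l).Finite := by
  have h : eqnVars l = ⋃ e ∈ {e | e ∈ l}, (e.1.FV ∪ e.2.FV) := by
    ext v
    simp [eqnVars]
  rw [h]
  exact l.finite_toSet.biUnion fun e _ => e.1.finite_FV.union e.2.finite_FV

theorem unifies_cons {θ : ∀ ρ, ℕ → Expr S [] ρ} {e : Expr S [] .i × Expr S [] .i} :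
    Unifies θ (e :: l) ↔ e.1.sub θ = e.2.sub θ ∧ Unifies θ l := by
  simp [Unifies]

theorem HasMGU.congr {l' : List (Expr S [] .i × Expr S [] .i)} (h : HasMGU X l')
    (hl : ∀ θ : ∀ ρ, ℕ → Expr S [] ρ, Unifies θ l ↔ Unifies θ l') : HasMGU X l := by
  intro τ hX hτ
  obtain ⟨μ, h0, hu, hμX, hσ⟩ := h τ hX ((hl τ).1 hτ)
  exact ⟨μ, h0, (hl _).2 hu, hμX, fun σ hs => hσ σ ((hl σ).1 hs)⟩

theorem HasMGU.swap {a b : Expr S [] .i} (h : HasMGU X ((b, a) :: l)) :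
    HasMGU X ((a, b) :: l) :=
  h.congr fun θ => by simp only [unifies_cons, eq_comm]

/-- The variable `n` is eliminated with the equation `n ≈ t`. -/
theorem hasMGU_eliminate {n : ℕ} {t : Expr S [] .i} (hnX : (.i, n) ∉ X)
    (hnt : ((.i, n) : Var) ∉ t.FV)
    (IH : ∀ l' : List (Expr S [] .i × Expr S [] .i),
      (eqnVars l').ncard < (eqnVars ((.fvar .i n, t) :: l)).ncard → HasMGU X l') :
    HasMGU X ((.fvar .i n, t) :: l) := by
  intro τ hX hτ
  set δ : Subst S := .single .i n t with hδ
  set l' := l.map fun e => (e.1.sub δ.toFun, e.2.sub δ.toFun) with hl'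
  have ht : t.sub δ.toFun = t := Expr.sub_eq_self fun v hv =>
    Subst.single_of_ne t fun h => hnt (h ▸ hv)
  -- A solution of `n ≈ t` is unchanged when preceded by the elimination `δ`.
  have habs : ∀ {σ : ∀ ρ, ℕ → Expr S [] ρ}, t.sub σ = σ .i n → ∀ E : Expr S [] .i,
      (E.sub δ.toFun).sub σ = E.sub σ := by
    intro σ h E
    rw [Expr.sub_sub]
    exact Expr.sub_congr fun v _ => Subst.single_sub h v.1 v.2
  have hl : ∀ {σ : ∀ ρ, ℕ → Expr S [] ρ}, Unifies σ ((.fvar .i n, t) :: l) →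
      t.sub σ = σ .i n ∧ Unifies σ l' := by
    intro σ hσ
    obtain ⟨h₁, h₂⟩ := unifies_cons.1 hσ
    have h₁' : t.sub σ = σ .i n := h₁.symm
    refine ⟨h₁', fun e he => ?_⟩
    obtain ⟨e', he', rfl⟩ := List.mem_map.1 he
    rw [habs h₁', habs h₁']
    exact h₂ e' he'
  -- By the occurs check `n` is gone after the elimination, so the number of variables drops.
  have hvars : eqnVars l' ⊆ eqnVars ((.fvar .i n, t) :: l) \ {(.i, n)} := by
    have hE : ∀ E : Expr S [] .i, E.FV ⊆ eqnVars ((.fvar .i n, t) :: l) →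
        (E.sub δ.toFun).FV ⊆ eqnVars ((.fvar .i n, t) :: l) \ {(.i, n)} := by
      refine fun E hE => Expr.FV_sub_subset fun v hv => ?_
      by_cases hvn : v = (.i, n)
      · subst hvn
        rw [hδ, Subst.single_self]
        exact fun w hw => ⟨⟨_, List.mem_cons_self, Or.inr hw⟩, fun h => hnt (h ▸ hw)⟩
      · rw [hδ, Subst.single_of_ne t hvn]
        rintro _ rfl
        exact ⟨hE hv, hvn⟩
    rintro v ⟨e, he, hv⟩
    obtain ⟨e', he', rfl⟩ := List.mem_map.1 he
    rcases hv with hv | hv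
    · exact hE _ (fun w hw => ⟨e', List.mem_cons_of_mem _ he', Or.inl hw⟩) hv
    · exact hE _ (fun w hw => ⟨e', List.mem_cons_of_mem _ he', Or.inr hw⟩) hv
  have hcard : (eqnVars l').ncard < (eqnVars ((.fvar .i n, t) :: l)).ncard := by
    refine Set.ncard_lt_ncard ⟨hvars.trans Set.sdiff_subset, fun h => ?_⟩ (finite_eqnVars _)
    exact (hvars (h ⟨_, List.mem_cons_self, Or.inl rfl⟩ : ((.i, n) : Var) ∈ eqnVars l')).2 rfl
  obtain ⟨μ, h0, hu, hμX, hσ⟩ := IH l' hcard τ hX (hl hτ).2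
  refine ⟨δ.comp μ, ?_, ?_, ?_, ?_⟩
  · rw [Subst.isZeroOrder_iff] at h0 ⊢
    intro ρ m hρ
    change ((Subst.single .i n t).toFun ρ m).sub μ.toFun = _
    rw [Subst.single_of_ne t fun h => hρ (congrArg Prod.fst h)]
    exact h0 ρ m hρ
  · have hcomp : ∀ E : Expr S [] .i, E.sub (δ.comp μ).toFun = (E.sub δ.toFun).sub μ.toFun :=
      fun E => (Expr.sub_sub E _ _).symm
    refine unifies_cons.2 ⟨?_, fun e he => ?_⟩
    · rw [hcomp, hcomp, ht]
      change ((Subst.single .i n t).toFun .i n).sub μ.toFun = _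
      rw [Subst.single_self]
    · rw [hcomp, hcomp]
      exact hu (e.1.sub δ.toFun, e.2.sub δ.toFun) (List.mem_map_of_mem he)
  · intro v hv
    change ((Subst.single .i n t).toFun v.1 v.2).sub μ.toFun = _
    rw [Subst.single_of_ne t fun h => hnX (h ▸ hv)]
    exact hμX v hv
  · intro σ hs ρ m
    obtain ⟨h₁, h₂⟩ := hl hs
    change (((Subst.single .i n t).toFun ρ m).sub μ.toFun).sub σ = _
    rw [Expr.sub_sub, ← Subst.single_sub h₁ ρ m]
    exact Expr.sub_congr fun v _ => hσ σ h₂ v.1 v.2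

/-- `X` dictates the orientation. A solution fixing `X` cannot identify two distinct variables of
`X`, nor a variable of `X` with a constant or a compound term; so, unless the equation is trivial,
one of its sides is a variable outside `X`, and that one is eliminated. -/
theorem hasMGU_fvar_cons {n : ℕ} {t : Expr S [] .i} (hl : HasMGU X l)
    (IH : ∀ l' : List (Expr S [] .i × Expr S [] .i),
      (eqnVars l').ncard < (eqnVars ((.fvar .i n, t) :: l)).ncard → HasMGU X l') :
    HasMGU X ((.fvar .i n, t) :: l) := by
  intro τ hX hτ
  have h₁ : τ .i n = t.sub τ := (unifies_cons.1 hτ).1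
  suffices h : HasMGU X ((.fvar .i n, t) :: l) from h τ hX hτ
  have hne : ∀ {E : Expr S [] .i}, τ .i n = E → (∀ m, E ≠ .fvar .i m) → ((.i, n) : Var) ∉ X :=
    fun hE hm hn => hm n (hE.symm.trans (hX _ hn))
  induction t using Expr.term_induction with
  | fvar m =>
    by_cases hnm : n = m
    · subst hnm
      exact hl.congr fun θ => by simp [unifies_cons]
    have hne' : ((.i, n) : Var) ≠ (.i, m) := fun h => hnm (congrArg Prod.snd h)
    by_cases hn : ((.i, n) : Var) ∈ X
    · by_cases hm : ((.i, m) : Var) ∈ X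
      · have h₂ := (hX _ hn).symm.trans (h₁.trans (hX _ hm))
        exact absurd (Expr.fvar.inj h₂) (by simpa using hnm)
      · refine HasMGU.swap (hasMGU_eliminate hm (fun h => hne' h.symm) ?_)
        intro l' hl'
        refine IH l' (hl'.trans_eq (congrArg Set.ncard ?_))
        ext v
        simp [eqnVars, or_comm]
    · exact hasMGU_eliminate hn (fun h => hne' h) IH
  | const c =>
    exact hasMGU_eliminate (hne h₁ fun m h => by cases h) (fun h => h.elim) IH
  | func k f ts _ =>
    exact hasMGU_eliminate (hne h₁ fun m h => by cases h) (Expr.not_mem_FV_of_sub_eq_func h₁) IH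

/-- The inner induction is on the size of the left sides: deletion and decomposition decrease it and
add no variables, whereas elimination loses a variable and is covered by `IH`. -/
theorem hasMGU_of_bound (N : ℕ)
    (IH : ∀ l' : List (Expr S [] .i × Expr S [] .i), (eqnVars l').ncard < N → HasMGU X l') :
    ∀ (M : ℕ) (l : List (Expr S [] .i × Expr S [] .i)), (eqnVars l).ncard ≤ N → eqnSize l < M →
      HasMGU X l := by
  intro M
  induction M with
  | zero => intro l _ h; exact absurd h (Nat.not_lt_zero _)
  | succ M ih =>
    intro l hN hM
    rcases l with _ | ⟨⟨a, b⟩, l⟩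
    · intro τ _ _
      exact ⟨.id, fun v hv => (hv rfl).elim, fun e he => by simp at he, fun _ _ => rfl,
        fun σ _ ρ n => rfl⟩
    have hsub : eqnVars l ⊆ eqnVars ((a, b) :: l) := fun v ⟨e, he, hv⟩ =>
      ⟨e, List.mem_cons_of_mem _ he, hv⟩
    have hl : HasMGU X l := by
      refine ih l ((Set.ncard_le_ncard hsub (finite_eqnVars _)).trans hN) ?_
      have := a.size_pos
      simp only [eqnSize, List.map_cons, List.sum_cons] at hM ⊢
      omega
    have hvar : ∀ n t, (a, b) = (.fvar .i n, t) ∨ (b, a) = (.fvar .i n, t) →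
        HasMGU X ((a, b) :: l) := by
      rintro n t (h | h)
      · rw [h] at hN ⊢
        exact hasMGU_fvar_cons hl fun l' hl' => IH l' (hl'.trans_le hN)
      · refine HasMGU.swap ?_
        rw [h]
        refine hasMGU_fvar_cons hl fun l' hl' => IH l' ((hl'.trans_eq ?_).trans_le hN)
        rw [← h]
        congr 1
        ext v
        simp [eqnVars, or_comm]
    intro τ hX hτ
    have h₁ : a.sub τ = b.sub τ := (unifies_cons.1 hτ).1
    suffices h : HasMGU X ((a, b) :: l) from h τ hX hτ
    cases a with
    | fvar _ n => exact hvar n b (Or.inl rfl)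
    | bvar x => exact isEmptyElim x
    | const c =>
      cases b with
      | fvar _ n => exact hvar n _ (Or.inr rfl)
      | bvar x => exact isEmptyElim x
      | const c' =>
        cases h₁
        exact hl.congr fun θ => by simp [unifies_cons]
      | func g us => cases h₁
    | @func _ k f ts =>
      cases b with
      | fvar _ n => exact hvar n _ (Or.inr rfl)
      | bvar x => exact isEmptyElim x
      | const c' => cases h₁
      | @func _ k' g us =>
        obtain ⟨rfl, hfg, -⟩ := Expr.func.inj h₁
        cases hfg
        have hu : ∀ θ : ∀ ρ, ℕ → Expr S [] ρ, Unifies θ ((.func f ts, .func f us) :: l) ↔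
            Unifies θ (List.ofFn (fun j => (ts j, us j)) ++ l) := by
          intro θ
          have h₂ : (Expr.func f ts).sub θ = (Expr.func f us).sub θ ↔
              ∀ j, (ts j).sub θ = (us j).sub θ := by
            constructor
            · intro h j
              exact congrFun (eq_of_heq (Expr.func.inj h).2.2) j
            · intro h
              exact congrArg (Expr.func f) (funext h)
          rw [unifies_cons, h₂]
          simp only [Unifies, List.mem_append, List.mem_ofFn]
          constructor
          · rintro ⟨h₃, h₄⟩ e (⟨j, rfl⟩ | he)
            · exact h₃ j
            · exact h₄ e he
          · intro h
            exact ⟨fun j => h _ (Or.inl ⟨j, rfl⟩), fun e he => h e (Or.inr he)⟩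
        refine HasMGU.congr (ih _ (le_trans (Set.ncard_le_ncard ?_ (finite_eqnVars _)) hN) ?_) hu
        · rintro v ⟨e, he, hv⟩
          rcases List.mem_append.1 he with he | he
          · obtain ⟨j, rfl⟩ := List.mem_ofFn.1 he
            refine ⟨_, List.mem_cons_self, ?_⟩
            exact hv.imp (fun h => Set.mem_iUnion.2 ⟨j, h⟩) fun h => Set.mem_iUnion.2 ⟨j, h⟩
          · exact ⟨e, List.mem_cons_of_mem _ he, hv⟩
        · simp only [eqnSize, List.map_cons, List.sum_cons, Expr.size, List.map_append,
            List.sum_append, List.map_ofFn, List.sum_ofFn, Function.comp_apply] at hM ⊢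
          omega

theorem hasMGU (X : Set Var) (l : List (Expr S [] .i × Expr S [] .i)) : HasMGU X l := by
  have h : ∀ N (l : List (Expr S [] .i × Expr S [] .i)), (eqnVars l).ncard < N → HasMGU X l := by
    intro N
    induction N with
    | zero => intro l hl; exact absurd hl (Nat.not_lt_zero _)
    | succ N ih =>
      intro l hl
      exact hasMGU_of_bound N ih _ l (Nat.lt_succ_iff.1 hl) (Nat.lt_succ_self _)
  exact h _ l (Nat.lt_succ_self _)

/-- For an idempotent most general solution every unifier satisfies `σ = μσ`, so the mediating
substitution is `σ` itself, which is zero-order. -/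
theorem exists_isMGU {t₁ t₂ : Expr S [] .i} {θ : ∀ ρ, ℕ → Expr S [] ρ}
    (hθ : t₁.sub θ = t₂.sub θ) (hX : ∀ v ∈ X, θ v.1 v.2 = .fvar v.1 v.2) :
    ∃ μ : Subst S, μ.IsMGU t₁ t₂ ∧ (∀ v ∈ X, μ.toFun v.1 v.2 = .fvar v.1 v.2) ∧
      ∀ ρ n, (μ.toFun ρ n).sub θ = θ ρ n := by
  have hu : ∀ {σ : ∀ ρ, ℕ → Expr S [] ρ}, t₁.sub σ = t₂.sub σ ↔ Unifies σ [(t₁, t₂)] := by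
    simp [Unifies]
  obtain ⟨μ, h0, hμ, hμX, hσ⟩ := hasMGU X [(t₁, t₂)] θ hX (hu.1 hθ)
  refine ⟨μ, ⟨⟨h0, hu.2 hμ⟩, fun σ hs => ⟨σ, hs.1, ?_⟩⟩, hμX, hσ θ (hu.1 hθ)⟩
  have h : σ.toFun = (μ.comp σ).toFun := by
    funext ρ n
    exact (hσ σ.toFun (hu.1 hs.2) ρ n).symm
  cases σ
  simp only [Subst.comp] at h ⊢
  congr

end HOLP

namespace HOLP

variable {S : Sig}

/-! ## Argument lists and substitutions -/

namespace Args

/-- Substitution in an argument list. -/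
def sub (θ : ∀ ρ, ℕ → Expr S [] ρ) : {π : PTy} → Args S π → Args S π
  | _, nil => nil
  | _, cons E as => cons (E.sub θ) (as.sub θ)

/-- The free variables of an argument list. -/
def FV : {π : PTy} → Args S π → Set Var
  | _, nil => ∅
  | _, cons E as => E.FV ∪ as.FV

theorem sub_apply (θ : ∀ ρ, ℕ → Expr S [] ρ) {π : PTy} (as : Args S π) :
    ∀ E : Expr S [] (.pred π), (as.apply E).sub θ = (as.sub θ).apply (E.sub θ) := by
  induction as with
  | nil => intro E; rfl
  | cons E₁ as ih => intro E; exact ih (.app E E₁)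

theorem FV_apply {π : PTy} (as : Args S π) :
    ∀ E : Expr S [] (.pred π), (as.apply E).FV = E.FV ∪ as.FV := by
  induction as with
  | nil => intro E; exact (Set.union_empty _).symm
  | cons E₁ as ih => intro E; exact (ih (.app E E₁)).trans (Set.union_assoc _ _ _)

theorem sub_sub (θ σ : ∀ ρ, ℕ → Expr S [] ρ) {π : PTy} (as : Args S π) :
    (as.sub θ).sub σ = as.sub fun ρ n => (θ ρ n).sub σ := by
  induction as with
  | nil => rfl
  | cons E as ih => simp only [sub, ih, Expr.sub_sub]

theorem sub_congr {θ σ : ∀ ρ, ℕ → Expr S [] ρ} {π : PTy} {as : Args S π}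
    (h : ∀ v ∈ as.FV, θ v.1 v.2 = σ v.1 v.2) : as.sub θ = as.sub σ := by
  induction as with
  | nil => rfl
  | cons E as ih =>
    simp only [sub]
    rw [Expr.sub_congr fun v hv => h v (Or.inl hv), ih fun v hv => h v (Or.inr hv)]

theorem eq_nil (as : Args S .o) : as = nil := by
  cases as
  rfl

theorem exists_eq_cons {ρ : ATy} {π : PTy} (as : Args S (.arr ρ π)) :
    ∃ E as', as = cons E as' := by
  cases as
  exact ⟨_, _, rfl⟩

end Args

namespace Subst

theorem finite_vars (θ : Subst S) : θ.vars.Finite :=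
  θ.finite.union (θ.finite.biUnion fun _ _ => Expr.finite_FV _)

theorem FV_toFun_subset (θ : Subst S) {U : Set Var} {v : Var} (hv : v ∈ U) :
    (θ.toFun v.1 v.2).FV ⊆ U ∪ θ.vars := by
  by_cases h : v ∈ θ.dom
  · exact fun w hw => Or.inr (Or.inr (Set.mem_biUnion h hw))
  · rw [show θ.toFun v.1 v.2 = .fvar v.1 v.2 from not_not.1 h]
    rintro _ rfl
    exact Or.inl hv

theorem FV_sub_subset (θ : Subst S) {U : Set Var} {ρ : ATy} {E : Expr S [] ρ} (hE : E.FV ⊆ U) :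
    (E.sub θ.toFun).FV ⊆ U ∪ θ.vars :=
  Expr.FV_sub_subset fun _ hv => θ.FV_toFun_subset (hE hv)

theorem isBasic_id : (id : Subst S).IsBasic := fun _ hv => (hv rfl).elim

theorem IsZeroOrder.isBasic {θ : Subst S} (h : θ.IsZeroOrder) : θ.IsBasic := by
  rintro ⟨ρ, n⟩ hv
  cases (show ρ = .i from h _ hv)
  exact .term _

theorem isBasic_single {ρ : ATy} {n : ℕ} {B : Expr S [] ρ} (hB : HOLP.IsBasic B) :
    (single ρ n B).IsBasic := by
  rintro ⟨τ, m⟩ hv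
  by_cases h : ((τ, m) : Var) = (ρ, n)
  · cases h
    rwa [single_self]
  · exact (hv (single_of_ne B h)).elim

theorem sub_compList_append (θs θs' : List (Subst S)) :
    ∀ {ρ : ATy} (E : Expr S [] ρ), E.sub (compList (θs ++ θs')).toFun =
      (E.sub (compList θs).toFun).sub (compList θs').toFun := by
  induction θs with
  | nil => intro ρ E; exact congrArg (fun F => Expr.sub F _) (Expr.sub_fvar E).symm
  | cons θ θs ih =>
    intro ρ E
    have h : ∀ θs : List (Subst S), E.sub (compList (θ :: θs)).toFun =
        (E.sub θ.toFun).sub (compList θs).toFun := fun θs => (Expr.sub_sub E _ _).symm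
    rw [List.cons_append, h, h, ih]

end Subst

/-! ## Derivations that record the variables in use -/

/-- A derivation, together with the set of the variables in use at its end. -/
inductive Deriv (P : Program S) : Set Var → Goal S → List (Subst S) → Goal S → Set Var → Prop
  | nil (U : Set Var) (A : Goal S) : Deriv P U A [] A U
  | cons {U U' : Set Var} {A A₁ A' : Goal S} {θ : Subst S} {θs : List (Subst S)}
      (hθ : θ.IsBasic) (h : Step P U A θ A₁)
      (hs : Deriv P (U ∪ θ.vars ∪ A₁.FV) A₁ θs A' U') : Deriv P U A (θ :: θs) A' U'

namespace Deriv

variable {P : Program S} {U U' : Set Var} {A A' : Goal S} {θs : List (Subst S)}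

theorem toDerivation (h : Deriv P U A θs A' U') : Derivation P U A θs A' := by
  induction h with
  | nil U A => exact .nil U A
  | cons hθ h _ ih => exact .cons hθ h ih

theorem trans {U'' : Set Var} {A'' : Goal S} {θs' : List (Subst S)} (h : Deriv P U A θs A' U')
    (h' : Deriv P U' A' θs' A'' U'') : Deriv P U A (θs ++ θs') A'' U'' := by
  induction h with
  | nil U A => exact h'
  | cons hθ h _ ih => exact .cons hθ h (ih h')

theorem finite (h : Deriv P U A θs A' U') (hU : U.Finite) : U'.Finite := by
  induction h with
  | nil U A => exact hU
  | cons _ _ _ ih => exact ih ((hU.union (Subst.finite_vars _)).union (Expr.finite_FV _))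

theorem subset (h : Deriv P U A θs A' U') : U ⊆ U' := by
  induction h with
  | nil U A => exact subset_rfl
  | cons _ _ _ ih => exact fun v hv => ih (Or.inl (Or.inl hv))

theorem FV_sub_subset (h : Deriv P U A θs A' U') :
    ∀ {ρ : ATy} {E : Expr S [] ρ}, E.FV ⊆ U → (E.sub (Subst.compList θs).toFun).FV ⊆ U' := by
  induction h with
  | nil U A =>
    intro ρ E hE
    rw [show E.sub (Subst.compList []).toFun = E from Expr.sub_fvar E]
    exact hE
  | @cons U U' A A₁ A' θ θs _ _ _ ih =>
    intro ρ E hE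
    have h := ih ((θ.FV_sub_subset hE).trans (Set.subset_union_left (t := A₁.FV)))
    rwa [Expr.sub_sub] at h

/-- A derivation carried out in the left member of a conjunction. -/
theorem frame (h : Deriv P U A θs A' U') : ∀ {B : Goal S}, B.FV ⊆ U →
    Deriv P U (.and A B) θs (.and A' (B.sub (Subst.compList θs).toFun)) U' := by
  induction h with
  | nil U A =>
    intro B _
    rw [show B.sub (Subst.compList []).toFun = B from Expr.sub_fvar B]
    exact .nil _ _
  | @cons U U' A A₁ A' θ θs hθ hstep _ ih =>
    intro B hB
    have hB' : (B.sub θ.toFun).FV ⊆ U ∪ θ.vars := θ.FV_sub_subset hB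
    have h := ih (hB'.trans (Set.subset_union_left (t := A₁.FV)))
    rw [Expr.sub_sub] at h
    refine .cons hθ (.andLeft B hstep) ?_
    -- The other conjunct adds no variable to those in use, so the freshness conditions of the
    -- remaining steps are unchanged.
    have hU : U ∪ θ.vars ∪ (Expr.and A₁ (B.subst θ)).FV = U ∪ θ.vars ∪ A₁.FV := by
      change U ∪ θ.vars ∪ (A₁.FV ∪ (B.sub θ.toFun).FV) = _
      rw [Set.union_comm A₁.FV, ← Set.union_assoc, Set.union_eq_left.2 hB']
    rw [hU]
    exact h

end Deriv

/-! ## Lifting provability to refutations -/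

/-- `θ` takes witnesses as values and fixes the variables in `X`. -/
structure IsSolution (X : Set Var) (θ : ∀ ρ, ℕ → Expr S [] ρ) : Prop where
  witness : ∀ ρ n, IsWitness (θ ρ n)
  fixes : ∀ v ∈ X, θ v.1 v.2 = .fvar v.1 v.2

/-- The formula `A` has a refutation that fixes the variables in `X` and is at least as general
as `θ`. -/
def Refutes (P : Program S) (X U : Set Var) (A : Goal S) (θ : ∀ ρ, ℕ → Expr S [] ρ) : Prop :=
  ∃ (θs : List (Subst S)) (U' : Set Var) (γ : ∀ ρ, ℕ → Expr S [] ρ),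
    Deriv P U A θs .top U' ∧ IsSolution X γ ∧
    (∀ v ∈ X, (Subst.compList θs).toFun v.1 v.2 = .fvar v.1 v.2) ∧
    ∀ v ∈ U, ((Subst.compList θs).toFun v.1 v.2).sub γ = θ v.1 v.2

namespace Refutes

variable {P : Program S} {X U : Set Var} {A A₁ : Goal S} {θ θ' : ∀ ρ, ℕ → Expr S [] ρ}

theorem top (hθ : IsSolution X θ) : Refutes P X U .top θ :=
  ⟨[], U, θ, .nil _ _, hθ, fun _ _ => rfl, fun _ _ => rfl⟩

/-- On the variables in use `θ` factors as `φ` followed by `θ'`, so the remaining refutation has to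
be general only with respect to `θ'`. -/
theorem step {φ : Subst S} (hφ : φ.IsBasic) (h : Step P U A φ A₁)
    (hX : ∀ v ∈ X, φ.toFun v.1 v.2 = .fvar v.1 v.2)
    (hU : ∀ v ∈ U, (φ.toFun v.1 v.2).sub θ' = θ v.1 v.2)
    (h₁ : Refutes P X (U ∪ φ.vars ∪ A₁.FV) A₁ θ') : Refutes P X U A θ := by
  obtain ⟨θs, U', γ, hd, hγ, hsX, hsU⟩ := h₁
  refine ⟨φ :: θs, U', γ, .cons hφ h hd, hγ, fun v hv => ?_, fun v hv => ?_⟩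
  · change (φ.toFun v.1 v.2).sub (Subst.compList θs).toFun = _
    rw [hX v hv]
    exact hsX v hv
  · change ((φ.toFun v.1 v.2).sub (Subst.compList θs).toFun).sub γ = _
    rw [Expr.sub_sub, ← hU v hv]
    exact Expr.sub_congr fun w hw => hsU w (Or.inl (φ.FV_toFun_subset hv hw))

theorem step_id (h : Step P U A .id A₁) (hU : ∀ v ∈ U, θ' v.1 v.2 = θ v.1 v.2)
    (h₁ : Refutes P X (U ∪ Subst.vars (S := S) .id ∪ A₁.FV) A₁ θ') : Refutes P X U A θ :=
  step Subst.isBasic_id h (fun _ _ => rfl) hU h₁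

/-- The conjuncts share variables: the second is refuted after the substitution `σ` of the first,
for the residual solution `γ`. Hence `h₂` ranges over all factorizations of `θ` through some `σ` and
`γ`. -/
theorem and {A₂ : Goal S} (hU : U.Finite) (hXU : X ⊆ U) (hA₂ : A₂.FV ⊆ U)
    (h₁ : Refutes P X U A₁ θ)
    (h₂ : ∀ (U' : Set Var) (σ : Subst S) (γ : ∀ ρ, ℕ → Expr S [] ρ), IsSolution X γ →
      U'.Finite → X ⊆ U' → (A₂.sub σ.toFun).FV ⊆ U' →
      (∀ v ∈ U, (σ.toFun v.1 v.2).sub γ = θ v.1 v.2) → Refutes P X U' (A₂.sub σ.toFun) γ) :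
    Refutes P X U (.and A₁ A₂) θ := by
  obtain ⟨θs, U₁, γ, hd, hγ, hsX, hsU⟩ := h₁
  have hfin : U₁.Finite := hd.finite hU
  have h₃ : Refutes P X U₁ (.and .top (A₂.sub (Subst.compList θs).toFun)) γ := by
    refine step_id (.oneAnd _) (fun _ _ => rfl) (h₂ _ _ γ hγ ?_ ?_ Set.subset_union_right hsU)
    · exact (hfin.union (Subst.finite_vars _)).union (Expr.finite_FV _)
    · exact fun v hv => Or.inl (Or.inl (hd.subset (hXU hv)))
  obtain ⟨θs', U₂, γ', hd', hγ', hsX', hsU'⟩ := h₃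
  have happ : ∀ v : Var, (Subst.compList (θs ++ θs')).toFun v.1 v.2 =
      ((Subst.compList θs).toFun v.1 v.2).sub (Subst.compList θs').toFun := fun v =>
    Subst.sub_compList_append θs θs' (.fvar v.1 v.2)
  refine ⟨θs ++ θs', U₂, γ', (hd.frame hA₂).trans hd', hγ', fun v hv => ?_, fun v hv => ?_⟩
  · rw [happ, hsX v hv]
    exact hsX' v hv
  · rw [happ, Expr.sub_sub, ← hsU v hv]
    refine Expr.sub_congr fun w hw => hsU' w (hd.FV_sub_subset (E := .fvar v.1 v.2) ?_ hw)
    rintro _ rfl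
    exact hv

end Refutes

/-- Every instance of `H as` by a solution comes from a refutation. -/
def Lifts (P : Program S) (X : Set Var) {π : PTy} (H : Expr S [] (.pred π)) (as : Args S π) :
    Prop :=
  ∀ (H₀ : Expr S [] (.pred π)) (as₀ : Args S π) (θ : ∀ ρ, ℕ → Expr S [] ρ) (U : Set Var),
    H₀.sub θ = H → as₀.sub θ = as → IsSolution X θ → U.Finite → X ⊆ U →
    (as₀.apply H₀).FV ⊆ U → Refutes P X U (as₀.apply H₀) θ

/-- As `Lifts`, for heads that are not variables. -/
def LiftsRigid (P : Program S) (X : Set Var) {π : PTy} (H : Expr S [] (.pred π))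
    (as : Args S π) : Prop :=
  ∀ (H₀ : Expr S [] (.pred π)) (as₀ : Args S π) (θ : ∀ ρ, ℕ → Expr S [] ρ) (U : Set Var),
    (∀ n, H₀ ≠ .fvar _ n) →
    H₀.sub θ = H → as₀.sub θ = as → IsSolution X θ → U.Finite → X ⊆ U →
    (as₀.apply H₀).FV ⊆ U → Refutes P X U (as₀.apply H₀) θ

variable {P : Program S} {X U : Set Var}

/-! ### Templates for patterns -/

namespace Pattern

/-- A pattern with the terms replaced by the variables `k, k + 1, …`. -/
def template : {π : PTy} → Pattern S π → ℕ → Pattern S π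
  | _, nil, _ => nil
  | _, ind _ p, k => ind (.fvar .i k) (p.template (k + 1))
  | _, any p, k => any (p.template k)

/-- A list of patterns with the terms replaced by the variables `k, k + 1, …`. -/
def templates {π : PTy} : List (Pattern S π) → ℕ → List (Pattern S π)
  | [], _ => []
  | p :: ps, k => p.template k :: templates ps (k + p.terms.length)

theorem terms_template {π : PTy} (p : Pattern S π) :
    ∀ k, (p.template k).terms = (List.range' k p.terms.length).map fun n => .fvar .i n := by
  induction p with
  | nil => intro k; rfl
  | ind t p ih =>
    intro k
    simp only [template, terms, ih, List.length_cons, List.range'_succ, List.map_cons]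
  | any p ih => exact fun k => ih k

theorem terms_templates {π : PTy} (ps : List (Pattern S π)) :
    ∀ k, (templates ps k).flatMap terms =
      (List.range' k (ps.flatMap terms).length).map fun n => .fvar .i n := by
  induction ps with
  | nil => intro k; rfl
  | cons p ps ih =>
    intro k
    rw [templates, List.flatMap_cons, ih, terms_template, ← List.map_append, List.flatMap_cons,
      List.length_append, List.range'_append_1]

theorem template_sub_shift (k : ℕ) {π : PTy} (p : Pattern S π) :
    ∀ m, (p.template m).sub (fun ρ n => .fvar ρ (k + n)) = p.template (k + m) := by
  induction p with
  | nil => intro m; rfl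
  | ind t p ih => intro m; simp only [template, sub, ih, ← Nat.add_assoc]; rfl
  | any p ih => intro m; simp only [template, sub, ih]

theorem templates_sub_shift (k : ℕ) {π : PTy} (ps : List (Pattern S π)) :
    ∀ m, (templates ps m).map (sub fun ρ n => .fvar ρ (k + n)) = templates ps (k + m) := by
  induction ps with
  | nil => intro m; rfl
  | cons p ps ih =>
    intro m
    simp only [templates, List.map_cons, template_sub_shift, ih, Nat.add_assoc]

theorem template_sub {θ : ∀ ρ, ℕ → Expr S [] ρ} {π : PTy} (p : Pattern S π) :
    ∀ k, (∀ j t, p.terms[j]? = some t → θ .i (k + j) = t) → (p.template k).sub θ = p := by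
  induction p with
  | nil => intro k _; rfl
  | ind t p ih =>
    intro k h
    have h₀ : θ .i k = t := h 0 t rfl
    have h₁ := ih (k + 1) fun j t ht => by
      rw [Nat.add_assoc, Nat.add_comm 1]
      exact h (j + 1) t (by simpa [terms] using ht)
    simp only [template, sub, h₁]
    exact congrArg (ind · p) h₀
  | any p ih =>
    intro k h
    exact congrArg any (ih k h)

theorem templates_sub {θ : ∀ ρ, ℕ → Expr S [] ρ} {π : PTy} (ps : List (Pattern S π)) :
    ∀ k, (∀ j t, (ps.flatMap terms)[j]? = some t → θ .i (k + j) = t) →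
      (templates ps k).map (sub θ) = ps := by
  induction ps with
  | nil => intro k _; rfl
  | cons p ps ih =>
    intro k h
    rw [List.flatMap_cons] at h
    rw [templates, List.map_cons, p.template_sub k fun j t ht => h j t ?_, ih _ fun j t ht => ?_]
    · rw [Nat.add_assoc]
      refine h _ t ?_
      rwa [List.getElem?_append_right (Nat.le_add_right _ _), Nat.add_sub_cancel_left]
    · rwa [List.getElem?_append_left (List.getElem?_eq_some_iff.1 ht).1]

/-- Only the terms of the patterns become variables. Thus `θ` is changed at individual variables
alone, where every value is a witness. -/
theorem exists_template {ρ : ATy} {π : PTy} (p : Pattern S (.arr ρ π))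
    (ps : List (Pattern S (.arr ρ π))) (hU : U.Finite) {θ : ∀ ρ, ℕ → Expr S [] ρ}
    (hθ : ∀ ρ n, IsWitness (θ ρ n)) :
    ∃ (q : Pattern S (.arr ρ π)) (qs : List (Pattern S (.arr ρ π))) (θ' : ∀ ρ, ℕ → Expr S [] ρ),
      IsTemplate (q.union qs) ∧ Disjoint (q.union qs).FV U ∧ (q.union qs).sub θ' = p.union ps ∧
      (∀ ρ n, IsWitness (θ' ρ n)) ∧ ∀ v ∈ U, θ' v.1 v.2 = θ v.1 v.2 := by
  -- Template variables are numbered from `k`, above every number in use.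
  obtain ⟨k, hk⟩ : ∃ k, ∀ v ∈ U, v.2 < k := by
    obtain ⟨m, hm⟩ := (hU.image Prod.snd).bddAbove
    exact ⟨m + 1, fun v hv => Nat.lt_succ_of_le (hm ⟨v, hv, rfl⟩)⟩
  set l := (p :: ps).flatMap terms with hl
  let θ' : ∀ ρ, ℕ → Expr S [] ρ := fun ρ n => match ρ with
    -- The template variable `k + j` takes the `j`-th term of the patterns; the default of `getD` is
    -- reached only beyond the template variables.
    | .i => if n < k then θ .i n else l.getD (n - k) (θ .i n)
    | .pred π => θ (.pred π) n
  have hsub : (templates (p :: ps) k).map (sub θ') = p :: ps := by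
    refine templates_sub _ k fun j t ht => ?_
    change (if k + j < k then θ .i (k + j) else l.getD (k + j - k) (θ .i (k + j))) = t
    rw [if_neg (by omega), Nat.add_sub_cancel_left, List.getD_eq_getElem?_getD, hl, ht,
      Option.getD_some]
  rw [templates, List.map_cons, List.cons.injEq] at hsub
  refine ⟨p.template k, templates ps (k + p.terms.length), θ', ?_, ?_, ?_, ?_, ?_⟩
  · refine .union _ _ ((List.range' k l.length).map fun n => (.i, n)) ?_ ?_
    · exact (List.nodup_range').map fun a b h => congrArg Prod.snd h
    · have h := flatMap_subexprs (templates (p :: ps) k)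
      rw [terms_templates, List.map_map] at h
      rw [List.map_map]
      exact h
  · have hshift : (p.template k).union (templates ps (k + p.terms.length)) =
        ((p.template 0).union (templates ps p.terms.length)).sub fun ρ n => .fvar ρ (k + n) := by
      rw [sub_union, template_sub_shift, templates_sub_shift, Nat.add_zero]
    rw [hshift, Set.disjoint_left]
    intro v hv hvU
    have h : v ∈ {v : Var | k ≤ v.2} := by
      refine Expr.FV_sub_subset (fun w _ => ?_) hv
      rintro _ rfl
      exact Nat.le_add_right _ _
    exact absurd (hk v hvU) (Nat.not_lt.2 h)
  · rw [sub_union, hsub.1, hsub.2]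
  · intro ρ n
    cases ρ with
    | i => exact .term _
    | pred π => exact hθ _ n
  · rintro ⟨ρ, n⟩ hv
    cases ρ with
    | i => exact if_pos (hk _ hv)
    | pred π => rfl

theorem isBasic_union {ρ : ATy} {π : PTy} (p : Pattern S (.arr ρ π))
    (ps : List (Pattern S (.arr ρ π))) : IsBasic (p.union ps) := by
  refine .union _ _ fun E hE => ?_
  rw [← List.map_cons (f := toPiece), flatMap_subexprs] at hE
  obtain ⟨t, -, rfl⟩ := List.mem_map.1 hE
  exact .term t

theorem union_ne_fvar {π : PTy} (p : Pattern S π) (hπ : π ≠ .o) (ps : List (Pattern S π)) (n : ℕ) :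
    p.union ps ≠ .fvar _ n := by
  cases ps with
  | nil =>
    cases p with
    | nil => exact (hπ rfl).elim
    | _ => exact fun h => by cases h
  | cons q qs => exact fun h => by cases h

end Pattern

/-- The template step makes the head rigid while `B` still instantiates to `H`, so the rigid lifting
property for the same `H` and `as` applies. The bound variable lies outside `X`, since its value `H`
is not a variable. -/
theorem refutes_template {π : PTy} {as : Args S π} {H B : Expr S [] (.pred π)} {n : ℕ}
    {as₀ : Args S π} {θ θ' : ∀ ρ, ℕ → Expr S [] ρ} (hrigid : LiftsRigid P X H as)
    (hH : θ (.pred π) n = H) (has : as₀.sub θ = as) (hθ : IsSolution X θ) (hU : U.Finite)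
    (hXU : X ⊆ U) (hFV : (as₀.apply (.fvar (.pred π) n)).FV ⊆ U) (hB : IsTemplate B)
    (hbasic : IsBasic B) (hBne : ∀ m, B ≠ .fvar _ m) (hHne : ∀ m, H ≠ .fvar _ m)
    (hBU : Disjoint B.FV U) (hBH : B.sub θ' = H) (hθ' : ∀ ρ n, IsWitness (θ' ρ n))
    (hθU : ∀ v ∈ U, θ' v.1 v.2 = θ v.1 v.2) :
    Refutes P X U (as₀.apply (.fvar (.pred π) n)) θ := by
  have hnX : ((.pred π, n) : Var) ∉ X := fun h => hHne n (hH.symm.trans (hθ.fixes _ h))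
  have hnU : ((.pred π, n) : Var) ∈ U := hFV (by rw [Args.FV_apply]; exact Or.inl rfl)
  have hsingle : ∀ v ∈ U, ((Subst.single (.pred π) n B).toFun v.1 v.2).sub θ' = θ v.1 v.2 := by
    intro v hv
    rw [Subst.single_sub (hBH.trans (hH.symm.trans (hθU _ hnU).symm)), hθU v hv]
  refine .step (Subst.isBasic_single hbasic) (.template n as₀ B hB hBU) (fun v hv => ?_) hsingle ?_
  · exact Subst.single_of_ne B fun h => hnX (h ▸ hv)
  rw [Expr.subst_eq_sub, Args.sub_apply]
  rw [show (Expr.fvar (.pred π) n).sub (Subst.single (.pred π) n B).toFun = B from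
    Subst.single_self _ n B]
  refine hrigid _ _ θ' _ hBne hBH ?_ ⟨hθ', fun v hv => ?_⟩ ?_ ?_ Set.subset_union_right
  · rw [Args.sub_sub, ← has]
    refine Args.sub_congr fun v hv => hsingle v (hFV ?_)
    rw [Args.FV_apply]
    exact Or.inr hv
  · rw [hθU v (hXU hv), hθ.fixes v hv]
  · exact (hU.union (Subst.finite_vars _)).union (Expr.finite_FV _)
  · exact fun v hv => Or.inl (Or.inl (hXU hv))

/-- The value of a variable head is a witness, and no rule of `Prov` applies to a variable; so the
value is `1` or a union of patterns, both instances of templates. -/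
theorem LiftsRigid.lifts {π : PTy} {H : Expr S [] (.pred π)} {as : Args S π}
    (h : LiftsRigid P X H as) (hP : Prov P H as) : Lifts P X H as := by
  intro H₀ as₀ θ U hH has hθ hU hXU hFV
  by_cases hne : ∀ n, H₀ ≠ .fvar _ n
  · exact h H₀ as₀ θ U hne hH has hθ hU hXU hFV
  push Not at hne
  obtain ⟨n, rfl⟩ := hne
  have hH' : θ (.pred π) n = H := hH
  have hw : IsWitness H := hH' ▸ hθ.witness _ n
  cases hw with
  | var _ m => cases hP
  | one =>
    exact refutes_template h hH' has hθ hU hXU hFV .one .one (fun m h => by cases h)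
      (fun m h => by cases h) (Set.empty_disjoint _) rfl hθ.witness fun _ _ => rfl
  | union p ps =>
    obtain ⟨q, qs, θ', hT, hdisj, hsub, hw', hθU⟩ := p.exists_template ps hU hθ.witness
    exact refutes_template h hH' has hθ hU hXU hFV hT (q.isBasic_union qs)
      (q.union_ne_fvar (by simp) qs) (p.union_ne_fvar (by simp) ps) hdisj hsub hw' hθU

end HOLP

namespace HOLP

variable {S : Sig} {P : Program S} {X : Set Var}

/-! ### Inversion of substitution -/

namespace Expr

variable {π : PTy} {H₀ : Expr S [] (.pred π)} {θ : ∀ ρ, ℕ → Expr S [] ρ}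

/-- A substitution changes the outermost constructor only at a variable, so any other expression has
the same constructor as its instance. The following inversions hold for the same reason. -/
theorem sub_eq_app (hne : ∀ n, H₀ ≠ fvar _ n) {ρ : ATy} {E₁ : Expr S [] (.pred (.arr ρ π))}
    {E₂ : Expr S [] ρ} (h : H₀.sub θ = app E₁ E₂) :
    ∃ F₁ F₂, H₀ = app F₁ F₂ ∧ F₁.sub θ = E₁ ∧ F₂.sub θ = E₂ := by
  cases H₀ with
  | fvar _ n => exact (hne n rfl).elim
  | bvar x => exact isEmptyElim x
  | app F₁ F₂ =>
    obtain ⟨rfl, h₁, h₂⟩ := app.inj h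
    exact ⟨F₁, F₂, rfl, eq_of_heq h₁, eq_of_heq h₂⟩
  | _ => cases h

theorem sub_eq_pconst (hne : ∀ n, H₀ ≠ fvar _ n) {p : S.Pred π} (h : H₀.sub θ = pconst p) :
    H₀ = pconst p := by
  cases H₀ with
  | fvar _ n => exact (hne n rfl).elim
  | bvar x => exact isEmptyElim x
  | pconst q => exact h
  | _ => cases h

theorem sub_eq_or (hne : ∀ n, H₀ ≠ fvar _ n) {E₁ E₂ : Expr S [] (.pred π)}
    (h : H₀.sub θ = or E₁ E₂) : ∃ F₁ F₂, H₀ = or F₁ F₂ ∧ F₁.sub θ = E₁ ∧ F₂.sub θ = E₂ := by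
  cases H₀ with
  | fvar _ n => exact (hne n rfl).elim
  | bvar x => exact isEmptyElim x
  | or F₁ F₂ => exact ⟨F₁, F₂, rfl, (or.inj h).1, (or.inj h).2⟩
  | _ => cases h

theorem sub_eq_and (hne : ∀ n, H₀ ≠ fvar _ n) {E₁ E₂ : Expr S [] (.pred π)}
    (h : H₀.sub θ = and E₁ E₂) : ∃ F₁ F₂, H₀ = and F₁ F₂ ∧ F₁.sub θ = E₁ ∧ F₂.sub θ = E₂ := by
  cases H₀ with
  | fvar _ n => exact (hne n rfl).elim
  | bvar x => exact isEmptyElim x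
  | and F₁ F₂ => exact ⟨F₁, F₂, rfl, (and.inj h).1, (and.inj h).2⟩
  | _ => cases h

theorem sub_eq_lam {ρ : ATy} {H₀ : Expr S [] (.pred (.arr ρ π))} (hne : ∀ n, H₀ ≠ fvar _ n)
    {E : Expr S [ρ] (.pred π)} (h : H₀.sub θ = lam E) :
    ∃ F, H₀ = lam F ∧ F.subUnder θ = E := by
  cases H₀ with
  | fvar _ n => exact (hne n rfl).elim
  | bvar x => exact isEmptyElim x
  | lam F => exact ⟨F, rfl, lam.inj h⟩
  | _ => cases h

theorem sub_eq_top {H₀ : Expr S [] (.pred .o)} (hne : ∀ n, H₀ ≠ fvar _ n)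
    (h : H₀.sub θ = top) : H₀ = top := by
  cases H₀ with
  | fvar _ n => exact (hne n rfl).elim
  | bvar x => exact isEmptyElim x
  | top => rfl
  | _ => cases h

theorem sub_eq_eq {H₀ : Expr S [] (.pred .o)} (hne : ∀ n, H₀ ≠ fvar _ n)
    {t₁ t₂ : Expr S [] .i} (h : H₀.sub θ = eq t₁ t₂) :
    ∃ u₁ u₂, H₀ = eq u₁ u₂ ∧ u₁.sub θ = t₁ ∧ u₂.sub θ = t₂ := by
  cases H₀ with
  | fvar _ n => exact (hne n rfl).elim
  | bvar x => exact isEmptyElim x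
  | eq u₁ u₂ => exact ⟨u₁, u₂, rfl, (eq.inj h).1, (eq.inj h).2⟩
  | _ => cases h

theorem sub_eq_ex {H₀ : Expr S [] (.pred .o)} (hne : ∀ n, H₀ ≠ fvar _ n) {ρ : ATy}
    {E : Expr S [ρ] (.pred .o)} (h : H₀.sub θ = ex E) :
    ∃ F, H₀ = ex F ∧ F.subUnder θ = E := by
  cases H₀ with
  | fvar _ n => exact (hne n rfl).elim
  | bvar x => exact isEmptyElim x
  | ex F =>
    obtain ⟨rfl, h₁⟩ := ex.inj h
    exact ⟨F, rfl, eq_of_heq h₁⟩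
  | _ => cases h

end Expr

-- Lifting by induction on provability

/-- A step with the identity substitution to a formula with a known lifting property. -/
theorem Lifts.step_id {π : PTy} {H : Expr S [] (.pred π)} {as : Args S π} (h : Lifts P X H as)
    {U : Set Var} {A : Goal S} {H₁ : Expr S [] (.pred π)} {as₁ : Args S π}
    {θ : ∀ ρ, ℕ → Expr S [] ρ} (hstep : Step P U A .id (as₁.apply H₁)) (hH : H₁.sub θ = H)
    (has : as₁.sub θ = as) (hθ : IsSolution X θ) (hU : U.Finite) (hXU : X ⊆ U) :
    Refutes P X U A θ :=
  .step_id hstep (fun _ _ => rfl) (h H₁ as₁ θ _ hH has hθ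
    ((hU.union (Subst.finite_vars _)).union (Expr.finite_FV _))
    (fun _ hv => Or.inl (Or.inl (hXU hv))) Set.subset_union_right)

theorem Lifts.and {π : PTy} {E₁ E₂ : Expr S [] (.pred π)} {as : Args S π} (h₁ : Lifts P X E₁ as)
    (h₂ : Lifts P X E₂ as) {F₁ F₂ : Expr S [] (.pred π)} {as₀ : Args S π}
    {θ : ∀ ρ, ℕ → Expr S [] ρ} {U : Set Var} (hF₁ : F₁.sub θ = E₁) (hF₂ : F₂.sub θ = E₂)
    (has : as₀.sub θ = as) (hθ : IsSolution X θ) (hU : U.Finite) (hXU : X ⊆ U)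
    (hFV : (Expr.and (as₀.apply F₁) (as₀.apply F₂)).FV ⊆ U) :
    Refutes P X U (.and (as₀.apply F₁) (as₀.apply F₂)) θ := by
  have hFV₂ : (as₀.apply F₂).FV ⊆ U := fun v hv => hFV (Or.inr hv)
  refine .and hU hXU hFV₂ (h₁ F₁ as₀ θ U hF₁ has hθ hU hXU fun v hv => hFV (Or.inl hv)) ?_
  intro U' σ γ hγ hU' hXU' hFV' hσ
  rw [Args.sub_apply] at hFV' ⊢
  rw [Args.FV_apply] at hFV₂
  refine h₂ _ _ γ U' ?_ ?_ hγ hU' hXU' hFV'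
  · rw [Expr.sub_sub, ← hF₂]
    exact Expr.sub_congr fun v hv => hσ v (hFV₂ (Or.inl hv))
  · rw [Args.sub_sub, ← has]
    exact Args.sub_congr fun v hv => hσ v (hFV₂ (Or.inr hv))

theorem exists_fresh {U : Set Var} (hU : U.Finite) (ρ : ATy) : ∃ n, ((ρ, n) : Var) ∉ U := by
  obtain ⟨m, hm⟩ := (hU.image Prod.snd).bddAbove
  exact ⟨m + 1, fun h => absurd (hm ⟨_, h, rfl⟩) (Nat.not_succ_le_self m)⟩

open Classical in
theorem exists_update {U : Set Var} {θ : ∀ ρ, ℕ → Expr S [] ρ} (hθ : IsSolution X θ)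
    (hXU : X ⊆ U) {ρ : ATy} {n : ℕ} (hn : ((ρ, n) : Var) ∉ U) {B : Expr S [] ρ}
    (hB : IsWitness B) :
    ∃ θ' : ∀ ρ, ℕ → Expr S [] ρ, IsSolution X θ' ∧ θ' ρ n = B ∧
      ∀ v ∈ U, θ' v.1 v.2 = θ v.1 v.2 := by
  let θ' : ∀ ρ, ℕ → Expr S [] ρ := fun τ m =>
    -- `Subst.single` serves only to transport `B` along the equality of types.
    if ((τ, m) : Var) = (ρ, n) then (Subst.single ρ n B).toFun τ m else θ τ m
  have hself : θ' ρ n = B := (if_pos rfl).trans (Subst.single_self ρ n B)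
  have hU : ∀ v ∈ U, θ' v.1 v.2 = θ v.1 v.2 := by
    rintro ⟨τ, m⟩ hv
    exact if_neg fun h : ((τ, m) : Var) = (ρ, n) => hn (h ▸ hv)
  refine ⟨θ', ⟨fun τ m => ?_, fun v hv => (hU v (hXU hv)).trans (hθ.fixes v hv)⟩, hself, hU⟩
  by_cases h : ((τ, m) : Var) = (ρ, n)
  · cases h
    rwa [hself]
  · rw [show θ' τ m = θ τ m from if_neg h]
    exact hθ.witness τ m

/-- A rigid head fixes the last rule of the proof, which is simulated by a resolution step;
application alone needs none. The premises may have variable heads, which `LiftsRigid.lifts`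
handles. -/
theorem Prov.liftsRigid {π : PTy} {H : Expr S [] (.pred π)} {as : Args S π} (h : Prov P H as) :
    LiftsRigid P X H as := by
  induction h with
  | app h ih =>
    intro H₀ as₀ θ U hne hH has hθ hU hXU hFV
    obtain ⟨F₁, F₂, rfl, h₁, h₂⟩ := Expr.sub_eq_app hne hH
    exact ih.lifts h F₁ (.cons F₂ as₀) θ U h₁ (by rw [Args.sub, h₂, has]) hθ hU hXU hFV
  | clause cl hcl h ih =>
    intro H₀ as₀ θ U hne hH has hθ hU hXU hFV
    rw [Expr.sub_eq_pconst hne hH]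
    refine (ih.lifts h).step_id (.clause cl hcl as₀) ?_ has hθ hU hXU
    exact Expr.sub_eq_self fun v hv => by rw [cl.closed] at hv; exact hv.elim
  | beta h ih =>
    intro H₀ as₀ θ U hne hH has hθ hU hXU hFV
    obtain ⟨F, rfl, hF⟩ := Expr.sub_eq_lam hne hH
    obtain ⟨E₁, as₁, rfl⟩ := as₀.exists_eq_cons
    obtain ⟨h₁, h₂⟩ := Args.cons.inj has
    refine (ih.lifts h).step_id (.beta F E₁ as₁) ?_ h₂ hθ hU hXU
    rw [Expr.sub_inst, hF, h₁]
  | orLeft h ih =>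
    intro H₀ as₀ θ U hne hH has hθ hU hXU hFV
    obtain ⟨F₁, F₂, rfl, h₁, h₂⟩ := Expr.sub_eq_or hne hH
    exact (ih.lifts h).step_id (.orLeft F₁ F₂ as₀) h₁ has hθ hU hXU
  | orRight h ih =>
    intro H₀ as₀ θ U hne hH has hθ hU hXU hFV
    obtain ⟨F₁, F₂, rfl, h₁, h₂⟩ := Expr.sub_eq_or hne hH
    exact (ih.lifts h).step_id (.orRight F₁ F₂ as₀) h₂ has hθ hU hXU
  | @and π E' E'' as h' h'' ih' ih'' =>
    intro H₀ as₀ θ U hne hH has hθ hU hXU hFV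
    obtain ⟨F₁, F₂, rfl, h₁, h₂⟩ := Expr.sub_eq_and hne hH
    cases π with
    | o =>
      -- At type `o` the formula already is a conjunction, so no distribution step is made.
      rw [as₀.eq_nil] at has hFV ⊢
      exact (ih'.lifts h').and (ih''.lifts h'') h₁ h₂ has hθ hU hXU hFV
    | arr ρ π =>
      refine .step_id (.andApply F₁ F₂ as₀) (fun _ _ => rfl)
        ((ih'.lifts h').and (ih''.lifts h'') h₁ h₂ has hθ ?_ ?_ Set.subset_union_right)
      · exact (hU.union (Subst.finite_vars _)).union (Expr.finite_FV _)
      · exact fun v hv => Or.inl (Or.inl (hXU hv))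
  | top =>
    intro H₀ as₀ θ U hne hH has hθ hU hXU hFV
    rw [Expr.sub_eq_top hne hH, as₀.eq_nil]
    exact .top hθ
  | eq t =>
    intro H₀ as₀ θ U hne hH has hθ hU hXU hFV
    obtain ⟨u₁, u₂, rfl, h₁, h₂⟩ := Expr.sub_eq_eq hne hH
    obtain ⟨μ, hμ, hμX, hμθ⟩ := exists_isMGU (h₁.trans h₂.symm) hθ.fixes
    rw [as₀.eq_nil]
    exact .step hμ.1.1.isBasic (.unify u₁ u₂ μ hμ) hμX (fun v _ => hμθ v.1 v.2) (.top hθ)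
  | @ex ρ E B hB h ih =>
    intro H₀ as₀ θ U hne hH has hθ hU hXU hFV
    obtain ⟨F, rfl, hF⟩ := Expr.sub_eq_ex hne hH
    rw [as₀.eq_nil] at hFV ⊢
    obtain ⟨n, hn⟩ := exists_fresh hU ρ
    -- The solution sends the released variable to the witness used in the proof.
    obtain ⟨θ', hθ', hself, hθU⟩ := exists_update hθ hXU hn hB
    refine .step_id (A₁ := F.inst (.fvar ρ n)) (.exists F n hn) hθU
      (ih.lifts h (F.inst (.fvar ρ n)) .nil θ' _ ?_ rfl hθ' ?_ ?_ Set.subset_union_right)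
    · rw [Expr.sub_inst, ← hF]
      change (F.subUnder θ').inst (θ' ρ n) = _
      rw [hself]
      congr 1
      exact Expr.bind_congr F _ fun v hv => congrArg Expr.wk (hθU v (hFV hv))
    · exact (hU.union (Subst.finite_vars _)).union (Expr.finite_FV _)
    · exact fun v hv => Or.inl (Or.inl (hXU hv))

theorem Prov.isComputedAnswer_id {A : Goal S} (h : Prov P A .nil) : IsComputedAnswer P A .id := by
  obtain ⟨θs, U', γ, hd, -, hX, -⟩ := h.liftsRigid.lifts h A .nil (fun ρ n => .fvar ρ n) A.FV
    (Expr.sub_fvar A) rfl ⟨IsWitness.fvar, fun _ _ => rfl⟩ A.finite_FV subset_rfl subset_rfl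
  refine ⟨θs, hd.toDerivation, ?_⟩
  unfold Subst.restrict Subst.id
  congr
  funext ρ n
  split
  · next hv => exact hX (ρ, n) hv
  · rfl

-- Provability of goals true in the minimum model

/-- A goal that is true in the minimum model under all states is provable: the individual variables
of the goal stand for constants that are not in use, and the predicate variables for the least element. -/
theorem prov_of_isTrue [Nonempty S.Const] {A : Goal S}
    (hfresh : {n : ℕ | (ATy.i, n) ∈ A.FV}.encard ≤
      {c : S.Const | c ∉ A.consts ∧ ∀ cl ∈ P, c ∉ cl.body.consts}.encard)
    (htrue : ∀ s : State (GTerm S), A.IsTrue (minModel P).toInterp s) : Prov P A .nil := by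
  classical
  have hfin : {n : ℕ | (ATy.i, n) ∈ A.FV}.Finite :=
    (A.finite_FV.image Prod.snd).subset fun n hn => ⟨_, hn, rfl⟩
  obtain ⟨g, hg, hinj⟩ := hfin.exists_injOn_of_encard_le hfresh
  -- The inverse of `g`: a constant standing for a variable is read as that variable, all others as
  -- themselves.
  let κ : S.Const → Expr S [] .i := fun c =>
    if h : ∃ n, (ATy.i, n) ∈ A.FV ∧ g n = c then .fvar .i h.choose else .const c
  have hκ : ∀ c, (∀ n, (ATy.i, n) ∈ A.FV → g n ≠ c) → κ c = .const c := fun c hc =>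
    dif_neg fun ⟨n, hn, h⟩ => hc n hn h
  have hκg : ∀ n, (ATy.i, n) ∈ A.FV → κ (g n) = .fvar .i n := by
    intro n hn
    have h : ∃ m, (ATy.i, m) ∈ A.FV ∧ g m = g n := ⟨n, hn, rfl⟩
    refine (dif_pos h).trans (congrArg (Expr.fvar .i) ?_)
    exact hinj h.choose_spec.1 hn h.choose_spec.2
  have hbot : ∀ {π : PTy}, IsCompactElement (⊥ : SemP (GTerm S) π) := fun t a ht _ _ _ =>
    ht.imp fun x hx => ⟨hx, bot_le⟩
  let s : State (GTerm S) := fun ρ n => match ρ with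
    | .i => (GTerm.const (g n) : GTerm S)
    | .pred π => (⟨⊥, hbot⟩ : {c : SemP (GTerm S) π // IsCompactElement c})
  have hmin := realizes_minModel (P := P) (κ := κ) fun cl hcl c hc =>
    hκ c fun n hn h => (hg hn).2 cl hcl (h ▸ hc)
  have h := realizedBy_denote (minModel P) hmin A
    (fun c hc => hκ c fun n hn h => (hg hn).1 (h ▸ hc)) ((fun _ x => nomatch x), s)
    (fun _ x => nomatch x) (fun ρ n => .fvar ρ n) (fun _ x => nomatch x) (by
      rintro ⟨ρ, n⟩ hv
      cases ρ with
      | i => exact hκg n hv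
      | pred π => exact Realizes.bot)
  have h' : Prov P (A.sub fun ρ n => .fvar ρ n) .nil := h (htrue s)
  rwa [Expr.sub_fvar] at h'

end HOLP

theorem mainTheorem7 (S : HOLP.Sig) [Nonempty S.Const] (P : HOLP.Program S) (A : HOLP.Goal S)
    (hfresh : {n : ℕ | (HOLP.ATy.i, n) ∈ A.FV}.encard ≤
      {c : S.Const | c ∉ A.consts ∧ ∀ cl ∈ P, c ∉ cl.body.consts}.encard)
    (htrue : ∀ s : HOLP.State (HOLP.GTerm S), A.IsTrue (HOLP.minModel P).toInterp s) :
    HOLP.IsComputedAnswer P A HOLP.Subst.id :=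
  (HOLP.prov_of_isTrue hfresh htrue).isComputedAnswer_id
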